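/- Let $G$ be a locally compact (Hausdorff) group with left Haar measure $dg$. Let $\lambda$ be the left regular representation of $G$ on $L^2(G)$, $(\lambda(g)\xi)(h)=\xi(g^{-1}h)$, and let $L(G)=\lambda(G)''\subset\mathcal B(L^2(G))$ be the group von Neumann algebra. A function $\varphi\colon G\to\mathbb C$ is a completely bounded Fourier multiplier if there is a $\sigma$-weakly continuous linear map $M_\varphi\colon L(G)\to L(G)$ with $M_\varphi(\lambda(g))=\varphi(g)\lambda(g)$ for all $g\in G$ and $M_\varphi$ is completely bounded. The space of these functions is denoted by $M_0A(G)$ and is normed by $\|\varphi\|_{M_0A(G)}=\|M_\varphi\|_{\mathrm{cb}}$. The weak$^*$ topology on $M_0A(G)$ is the one given by its predual $M_0A(G)_*$, the completion of $L^1(G)$ with respect to the norm $\|f\|=\sup\{|\int_G f\varphi\,dg| : \varphi\in M_0A(G),\ \|\varphi\|_{M_0A(G)}\le 1\}$, under the pairing $\langle f,\varphi\rangle=\int_G f\varphi\,dg$. A left invariant mean on $M_0A(G)$ is a positive linear functional $m\colon M_0A(G)\to\mathbb C$ with $\|m\|=m(1)=1$ (the norm of $m$ being taken with respect to the uniform norm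 on $M_0A(G)$) such that $m(L_g\varphi)=m(\varphi)$ for all $g\in G$ and $\varphi\in M_0A(G)$, where $(L_g\varphi)(h)=\varphi(g^{-1}h)$. The group $G$ has property (T$^*$) if $M_0A(G)$ has a unique left invariant mean and this mean is weak$^*$ continuous. Property (T$^*$) is inherited by quotients: if $G$ has property (T$^*$), then so does $G/N$ for every closed normal subgroup $N$ of $G$. -/

import Mathlib

open MeasureTheory Topology

noncomputable section

namespace PropTStar

section Operators

variable {H : Type*} [NormedAddCommGroup H] [InnerProductSpace ℂ H]

/-- An `n × n` matrix of bounded operators on `H`, as an operator on the Hilbert space `Hⁿ`. -/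
def opMatrix {n : ℕ} (x : Fin n → Fin n → (H →L[ℂ] H)) :
    PiLp 2 (fun _ : Fin n => H) →L[ℂ] PiLp 2 (fun _ : Fin n => H) :=
  ((PiLp.continuousLinearEquiv 2 ℂ (fun _ : Fin n => H)).symm :
      (Fin n → H) →L[ℂ] PiLp 2 (fun _ : Fin n => H)) ∘L
    (ContinuousLinearMap.pi fun i => ∑ j, x i j ∘L ContinuousLinearMap.proj j) ∘L
    ((PiLp.continuousLinearEquiv 2 ℂ (fun _ : Fin n => H)) :
      PiLp 2 (fun _ : Fin n => H) →L[ℂ] (Fin n → H))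

theorem opMatrix_apply {n : ℕ} (x : Fin n → Fin n → (H →L[ℂ] H))
    (v : PiLp 2 (fun _ : Fin n => H)) (i : Fin n) :
    opMatrix x v i = ∑ j, x i j (v j) := by
  simp [opMatrix]

theorem opMatrix_add {n : ℕ} (x y : Fin n → Fin n → (H →L[ℂ] H)) :
    opMatrix (fun i j => x i j + y i j) = opMatrix x + opMatrix y := by
  ext v i
  simp [opMatrix_apply, Finset.sum_add_distrib]

theorem opMatrix_smul {n : ℕ} (c : ℂ) (x : Fin n → Fin n → (H →L[ℂ] H)) :
    opMatrix (fun i j => c • x i j) = c • opMatrix x := by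
  ext v i
  simp [opMatrix_apply, Finset.smul_sum]

theorem opMatrix_mul_left {n : ℕ} (a : H →L[ℂ] H) (x : Fin n → Fin n → (H →L[ℂ] H)) :
    opMatrix (fun i j => a * x i j) =
      opMatrix (fun i j => if i = j then a else 0) ∘L opMatrix x := by
  ext v i
  simp [opMatrix_apply, apply_ite (fun T : H →L[ℂ] H => (T : H → H)), ite_apply]

theorem norm_opMatrix_diag_le {n : ℕ} (a : H →L[ℂ] H) (ha : ∀ v, ‖a v‖ ≤ ‖v‖) :
    ‖opMatrix (n := n) (fun i j => if i = j then a else 0)‖ ≤ 1 := by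
  refine ContinuousLinearMap.opNorm_le_bound _ zero_le_one fun v => ?_
  rw [one_mul, PiLp.norm_eq_of_L2, PiLp.norm_eq_of_L2]
  refine Real.sqrt_le_sqrt (Finset.sum_le_sum fun i _ => ?_)
  have : opMatrix (n := n) (fun i j => if i = j then a else 0) v i = a (v i) := by
    simp [opMatrix_apply, apply_ite (fun T : H →L[ℂ] H => (T : H → H)), ite_apply]
  rw [this]
  gcongr
  exact ha _

/-- The normal functional `T ↦ ∑ₙ ⟨T ξₙ, ηₙ⟩` for square summable sequences `ξ`, `η` in `H`. -/
def normalFunctional (ξ η : lp (fun _ : ℕ => H) 2) (T : H →L[ℂ] H) : ℂ :=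
  ∑' n, inner ℂ (η n) (T (ξ n))

variable (H) in
/-- The `σ`-weak (ultraweak) topology on the bounded operators of `H`. -/
abbrev ultraweakTopology : TopologicalSpace (H →L[ℂ] H) :=
  TopologicalSpace.induced
    (fun (T : H →L[ℂ] H) (p : lp (fun _ : ℕ => H) 2 × lp (fun _ : ℕ => H) 2) =>
      normalFunctional p.1 p.2 T) Pi.topologicalSpace

theorem summable_norm_mul_norm (ξ η : lp (fun _ : ℕ => H) 2) :
    Summable fun n => ‖η n‖ * ‖ξ n‖ := by
  have h1 := (lp.memℓp η).summable (by norm_num)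
  have h2 := (lp.memℓp ξ).summable (by norm_num)
  refine Summable.of_nonneg_of_le (fun n => by positivity) (fun n => ?_) (h1.add h2)
  simp only [ENNReal.toReal_ofNat, Real.rpow_ofNat]
  nlinarith [sq_nonneg (‖η n‖ - ‖ξ n‖), sq_nonneg (‖η n‖), sq_nonneg (‖ξ n‖)]

theorem summable_normalFunctional (ξ η : lp (fun _ : ℕ => H) 2) (T : H →L[ℂ] H) :
    Summable fun n => inner ℂ (η n) (T (ξ n)) := by
  refine Summable.of_norm_bounded ((summable_norm_mul_norm ξ η).mul_left ‖T‖) fun n => ?_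
  calc ‖inner ℂ (η n) (T (ξ n))‖ ≤ ‖η n‖ * ‖T (ξ n)‖ := norm_inner_le_norm _ _
    _ ≤ ‖η n‖ * (‖T‖ * ‖ξ n‖) := by gcongr; exact T.le_opNorm _
    _ = ‖T‖ * (‖η n‖ * ‖ξ n‖) := by ring

/-- `σ`-weak continuity is tested on normal functionals. -/
theorem continuous_ultraweak_iff {X : Type*} [TopologicalSpace X] (f : X → (H →L[ℂ] H)) :
    @Continuous X _ _ (ultraweakTopology H) f ↔
      ∀ ξ η : lp (fun _ : ℕ => H) 2, Continuous fun x => normalFunctional ξ η (f x) := by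
  rw [ultraweakTopology, continuous_induced_rng, continuous_pi_iff]
  exact ⟨fun h ξ η => h (ξ, η), fun h p => h p.1 p.2⟩

theorem continuous_normalFunctional (ξ η : lp (fun _ : ℕ => H) 2) :
    @Continuous _ _ (ultraweakTopology H) _ (normalFunctional ξ η) := by
  let _ := ultraweakTopology H
  exact (continuous_ultraweak_iff id).1 continuous_id ξ η

end Operators

section Multipliers

variable (G : Type*) [Group G] [TopologicalSpace G] [IsTopologicalGroup G]
  [LocallyCompactSpace G] [MeasurableSpace G] [BorelSpace G]

/-- The Hilbert space `L²(G)` for left Haar measure. -/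
abbrev L2 : Type _ := Lp ℂ 2 (Measure.haar : Measure G)

variable {G} in
/-- Left translation `(λ(g) ξ)(h) = ξ(g⁻¹ h)` as an isometry of `L²(G)`. -/
def leftRegularIsometry (g : G) : L2 G →ₗᵢ[ℂ] L2 G :=
  Lp.compMeasurePreservingₗᵢ ℂ (fun h : G => g⁻¹ * h)
    (measurePreserving_mul_left Measure.haar g⁻¹)

variable {G} in
/-- The left regular representation of `G` on `L²(G)`. -/
def leftRegular (g : G) : L2 G →L[ℂ] L2 G :=
  (leftRegularIsometry g).toContinuousLinearMap

/-- The group von Neumann algebra `L(G)`: the double commutant of `λ(G)` in `B(L²(G))`. -/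
def groupVN : VonNeumannAlgebra (L2 G) where
  toStarSubalgebra :=
    StarSubalgebra.centralizer ℂ
      (StarSubalgebra.centralizer ℂ (Set.range (leftRegular (G := G))) :
        Set (L2 G →L[ℂ] L2 G))
  centralizer_centralizer' := by simp

/-- The underlying `*`-algebra of `L(G)`. -/
abbrev LG : StarSubalgebra ℂ (L2 G →L[ℂ] L2 G) := (groupVN G).toStarSubalgebra

variable {G}

theorem norm_leftRegular_apply (g : G) (ξ : L2 G) : ‖leftRegular g ξ‖ = ‖ξ‖ :=
  (leftRegularIsometry g).norm_map ξ

theorem leftRegular_mul (g h : G) : leftRegular (g * h) = leftRegular g * leftRegular h := by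
  ext1 ξ
  change Lp.compMeasurePreserving _ _ ξ =
    Lp.compMeasurePreserving _ _ (Lp.compMeasurePreserving _ _ ξ)
  rw [← Lp.compMeasurePreserving_comp_apply]
  congr 1
  ext x
  simp [mul_assoc]

theorem leftRegular_one : leftRegular (1 : G) = 1 := by
  ext1 ξ
  change Lp.compMeasurePreserving _ _ ξ = ξ
  have h : (fun x : G => (1 : G)⁻¹ * x) = id := by ext x; simp
  simp only [h, Lp.compMeasurePreserving_id_apply]

theorem leftRegular_inv_apply (g : G) (ξ : L2 G) : leftRegular g (leftRegular g⁻¹ ξ) = ξ := by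
  rw [← mul_apply_eq_comp, ← leftRegular_mul, mul_inv_cancel, leftRegular_one]
  rfl

theorem leftRegular_mem (g : G) : leftRegular g ∈ LG G := by
  change leftRegular g ∈ StarSubalgebra.centralizer ℂ
      (StarSubalgebra.centralizer ℂ (Set.range (leftRegular (G := G))) :
        Set (L2 G →L[ℂ] L2 G))
  rw [← SetLike.mem_coe, StarSubalgebra.coe_centralizer_centralizer]
  exact Set.subset_centralizer_centralizer (Or.inl ⟨g, rfl⟩)

/-- `λ(g)` as an element of `L(G)`. -/
def lam (g : G) : LG G := ⟨leftRegular g, leftRegular_mem g⟩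

theorem lam_mul (g h : G) : lam (g * h) = lam g * lam h :=
  Subtype.ext (leftRegular_mul g h)

variable (G) in
/-- The `σ`-weak topology on `L(G)`. -/
abbrev ultraweakLG : TopologicalSpace (LG G) :=
  TopologicalSpace.induced (fun T : LG G => (T : L2 G →L[ℂ] L2 G)) (ultraweakTopology (L2 G))

/-- A linear map on `L(G)` is normal if it is `σ`-weakly continuous. -/
def IsNormalMap (M : LG G →ₗ[ℂ] LG G) : Prop :=
  @Continuous _ _ (ultraweakLG G) (ultraweakLG G) M

/-- All the amplifications `Mₙ(L(G)) → Mₙ(L(G))` of `M` are bounded by `C`. -/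
def CBBound (M : LG G →ₗ[ℂ] LG G) (C : ℝ) : Prop :=
  ∀ (n : ℕ) (x : Fin n → Fin n → LG G),
    ‖opMatrix fun i j => (M (x i j) : L2 G →L[ℂ] L2 G)‖ ≤
      C * ‖opMatrix fun i j => (x i j : L2 G →L[ℂ] L2 G)‖

/-- `M` is the map `M_φ`, i.e. the normal map on `L(G)` with `λ(g) ↦ φ(g) λ(g)`. -/
structure IsMultiplierMap (φ : G → ℂ) (M : LG G →ₗ[ℂ] LG G) : Prop where
  map_lam : ∀ g, M (lam g) = φ g • lam g
  normal : IsNormalMap M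

/-- `φ` is a completely bounded Fourier multiplier: `M_φ` exists and is completely bounded. -/
def IsCBMultiplier (φ : G → ℂ) : Prop :=
  ∃ M, IsMultiplierMap φ M ∧ ∃ C, CBBound M C

theorem isNormalMap_iff (M : LG G →ₗ[ℂ] LG G) :
    IsNormalMap M ↔ ∀ ξ η : lp (fun _ : ℕ => L2 G) 2,
      @Continuous _ _ (ultraweakLG G) _
        fun T : LG G => normalFunctional ξ η (M T : L2 G →L[ℂ] L2 G) := by
  let _ := ultraweakLG G
  rw [IsNormalMap, continuous_induced_rng]
  exact continuous_ultraweak_iff _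

theorem isNormalMap_id : IsNormalMap (LinearMap.id : LG G →ₗ[ℂ] LG G) := by
  let _ := ultraweakLG G
  exact continuous_id

theorem IsNormalMap.comp {M N : LG G →ₗ[ℂ] LG G} (hM : IsNormalMap M) (hN : IsNormalMap N) :
    IsNormalMap (M ∘ₗ N) := by
  let _ := ultraweakLG G
  change Continuous (M ∘ N)
  exact Continuous.comp (g := M) (f := N) hM hN

theorem IsNormalMap.add {M N : LG G →ₗ[ℂ] LG G} (hM : IsNormalMap M) (hN : IsNormalMap N) :
    IsNormalMap (M + N) := by
  rw [isNormalMap_iff] at *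
  intro ξ η
  let _ := ultraweakLG G
  refine ((hM ξ η).add (hN ξ η)).congr fun T => ?_
  refine ((summable_normalFunctional ξ η (M T)).tsum_add
    (summable_normalFunctional ξ η (N T))).symm.trans ?_
  exact tsum_congr fun n => (inner_add_right _ _ _).symm

theorem IsNormalMap.smul {M : LG G →ₗ[ℂ] LG G} (hM : IsNormalMap M) (c : ℂ) :
    IsNormalMap (c • M) := by
  rw [isNormalMap_iff] at *
  intro ξ η
  let _ := ultraweakLG G
  refine ((hM ξ η).const_smul c).congr fun T => ?_
  refine ((summable_normalFunctional ξ η (M T)).tsum_mul_left c).symm.trans ?_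
  exact tsum_congr fun n => (inner_smul_right _ _ _).symm

theorem inner_leftRegular (g : G) (ξ η : L2 G) :
    inner ℂ η (leftRegular g ξ) = inner ℂ (leftRegular g⁻¹ η) ξ := by
  have := (leftRegularIsometry g).inner_map_map (leftRegular g⁻¹ η) ξ
  rw [← this]
  congr 1
  exact (leftRegular_inv_apply g η).symm

theorem isNormalMap_mulLeft (g : G) :
    IsNormalMap (LinearMap.mulLeft ℂ (lam g) : LG G →ₗ[ℂ] LG G) := by
  rw [isNormalMap_iff]
  intro ξ η
  have hmem : Memℓp (fun n => leftRegular g⁻¹ (η n)) 2 := by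
    have := lp.memℓp η
    rw [memℓp_gen_iff (by norm_num)] at this ⊢
    simpa only [norm_leftRegular_apply] using this
  let _ := ultraweakLG G
  let _ := ultraweakTopology (L2 G)
  refine ((continuous_normalFunctional ξ ⟨_, hmem⟩).comp
    (continuous_induced_dom (f := fun T : LG G => (T : L2 G →L[ℂ] L2 G)))).congr fun T => ?_
  simp only [normalFunctional, Function.comp]
  refine tsum_congr fun n => ?_
  exact (inner_leftRegular g _ _).symm

theorem CBBound.mono {M : LG G →ₗ[ℂ] LG G} {C D : ℝ} (h : CBBound M C) (hCD : C ≤ D) :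
    CBBound M D := fun n x => (h n x).trans (by gcongr)

theorem cbBound_id : CBBound (LinearMap.id : LG G →ₗ[ℂ] LG G) 1 := fun n x => by simp

theorem CBBound.comp {M N : LG G →ₗ[ℂ] LG G} {C D : ℝ} (hM : CBBound M C) (hN : CBBound N D)
    (hC : 0 ≤ C) : CBBound (M ∘ₗ N) (C * D) := fun n x => by
  refine (hM n fun i j => N (x i j)).trans ?_
  rw [mul_assoc]
  exact mul_le_mul_of_nonneg_left (hN n x) hC

theorem CBBound.add {M N : LG G →ₗ[ℂ] LG G} {C D : ℝ} (hM : CBBound M C) (hN : CBBound N D) :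
    CBBound (M + N) (C + D) := fun n x => by
  rw [add_mul]
  refine le_trans ?_ (add_le_add (hM n x) (hN n x))
  refine le_trans (le_of_eq ?_) (norm_add_le _ _)
  rw [← opMatrix_add]
  rfl

theorem CBBound.smul {M : LG G →ₗ[ℂ] LG G} {C : ℝ} (hM : CBBound M C) (c : ℂ) :
    CBBound (c • M) (‖c‖ * C) := fun n x => by
  have : (opMatrix fun i j => (((c • M) (x i j) : LG G) : L2 G →L[ℂ] L2 G)) =
      c • opMatrix fun i j => (M (x i j) : L2 G →L[ℂ] L2 G) := by
    rw [← opMatrix_smul]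
    rfl
  rw [this, norm_smul, mul_assoc]
  exact mul_le_mul_of_nonneg_left (hM n x) (norm_nonneg c)

theorem cbBound_mulLeft (g : G) : CBBound (LinearMap.mulLeft ℂ (lam g) : LG G →ₗ[ℂ] LG G) 1 :=
  fun n x => by
  have : (opMatrix fun i j =>
      ((LinearMap.mulLeft ℂ (lam g) (x i j) : LG G) : L2 G →L[ℂ] L2 G)) =
      opMatrix (fun i j => if i = j then leftRegular g else 0) ∘L
        opMatrix fun i j => (x i j : L2 G →L[ℂ] L2 G) := by
    rw [← opMatrix_mul_left]
    rfl
  rw [this]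
  refine (ContinuousLinearMap.opNorm_comp_le _ _).trans ?_
  gcongr
  exact norm_opMatrix_diag_le _ fun v => (norm_leftRegular_apply g v).le

theorem IsMultiplierMap.add {φ ψ : G → ℂ} {M N : LG G →ₗ[ℂ] LG G} (hM : IsMultiplierMap φ M)
    (hN : IsMultiplierMap ψ N) : IsMultiplierMap (φ + ψ) (M + N) where
  map_lam g := by simp [hM.map_lam, hN.map_lam, add_smul]
  normal := hM.normal.add hN.normal

theorem IsMultiplierMap.smul {φ : G → ℂ} {M : LG G →ₗ[ℂ] LG G} (hM : IsMultiplierMap φ M)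
    (c : ℂ) : IsMultiplierMap (c • φ) (c • M) where
  map_lam g := by simp [hM.map_lam, smul_smul]
  normal := hM.normal.smul c

theorem isMultiplierMap_one : IsMultiplierMap (1 : G → ℂ) (LinearMap.id : LG G →ₗ[ℂ] LG G) where
  map_lam g := (one_smul ℂ (lam g)).symm
  normal := isNormalMap_id

theorem IsMultiplierMap.translate {φ : G → ℂ} {M : LG G →ₗ[ℂ] LG G} (hM : IsMultiplierMap φ M)
    (g : G) : IsMultiplierMap (fun h => φ (g⁻¹ * h))
      (LinearMap.mulLeft ℂ (lam g) ∘ₗ M ∘ₗ LinearMap.mulLeft ℂ (lam g⁻¹)) where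
  map_lam h := by
    simp only [LinearMap.comp_apply, LinearMap.mulLeft_apply, ← lam_mul, hM.map_lam,
      mul_smul_comm, mul_inv_cancel_left]
  normal := (isNormalMap_mulLeft g).comp (hM.normal.comp (isNormalMap_mulLeft g⁻¹))

variable (G) in
/-- The completely bounded Fourier multipliers as a space of functions on `G`. -/
def cbMultipliers : Submodule ℂ (G → ℂ) where
  carrier := {φ | IsCBMultiplier φ}
  add_mem' := by
    rintro φ ψ ⟨M, hM, C, hC⟩ ⟨N, hN, D, hD⟩
    exact ⟨M + N, hM.add hN, C + D, hC.add hD⟩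
  zero_mem' := by
    refine ⟨(0 : ℂ) • (LinearMap.id : LG G →ₗ[ℂ] LG G), ?_, _, cbBound_id.smul 0⟩
    simpa using (isMultiplierMap_one (G := G)).smul 0
  smul_mem' := by
    rintro c φ ⟨M, hM, C, hC⟩
    exact ⟨c • M, hM.smul c, _, hC.smul c⟩

variable (G) in
/-- The space `M₀A(G)`; a type synonym, as its topology is not that of pointwise convergence. -/
def M0A : Type _ := cbMultipliers G

namespace M0A

instance : AddCommGroup (M0A G) := inferInstanceAs (AddCommGroup (cbMultipliers G))

instance : Module ℂ (M0A G) := inferInstanceAs (Module ℂ (cbMultipliers G))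

instance : CoeFun (M0A G) (fun _ => G → ℂ) := ⟨fun φ => φ.1⟩

theorem ext {φ ψ : M0A G} (h : ∀ g, φ g = ψ g) : φ = ψ := Subtype.ext (funext h)

theorem add_apply (φ ψ : M0A G) (g : G) : (φ + ψ) g = φ g + ψ g := rfl

theorem smul_apply (c : ℂ) (φ : M0A G) (g : G) : (c • φ) g = c * φ g := rfl

/-- The constant function `1`. -/
instance : One (M0A G) := ⟨⟨1, LinearMap.id, isMultiplierMap_one, 1, cbBound_id⟩⟩

theorem one_apply (g : G) : (1 : M0A G) g = 1 := rfl

/-- Left translation `(L_g φ)(h) = φ(g⁻¹ h)`. -/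
def translate (g : G) (φ : M0A G) : M0A G :=
  ⟨fun h => φ (g⁻¹ * h), by
    obtain ⟨M, hM, C, hC⟩ := φ.2
    refine ⟨_, hM.translate g, 1 * (max C 0 * 1), ?_⟩
    exact (cbBound_mulLeft g).comp
      ((hC.mono (le_max_left _ _)).comp (cbBound_mulLeft g⁻¹) (le_max_right _ _)) zero_le_one⟩

theorem translate_apply (g : G) (φ : M0A G) (h : G) : translate g φ h = φ (g⁻¹ * h) := rfl

/-- `‖φ‖` is the completely bounded norm of `M_φ`, the least common bound for the norms of its
amplifications. -/
instance : Norm (M0A G) :=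
  ⟨fun φ => sInf {C : ℝ | 0 ≤ C ∧ ∃ M, IsMultiplierMap φ M ∧ CBBound M C}⟩

theorem norm_def (φ : M0A G) :
    ‖φ‖ = sInf {C : ℝ | 0 ≤ C ∧ ∃ M, IsMultiplierMap φ M ∧ CBBound M C} := rfl

theorem bound_nonempty (φ : M0A G) :
    {C : ℝ | 0 ≤ C ∧ ∃ M, IsMultiplierMap φ M ∧ CBBound M C}.Nonempty := by
  obtain ⟨M, hM, C, hC⟩ := φ.2
  exact ⟨max C 0, le_max_right _ _, M, hM, hC.mono (le_max_left _ _)⟩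

theorem bound_bddBelow (φ : M0A G) :
    BddBelow {C : ℝ | 0 ≤ C ∧ ∃ M, IsMultiplierMap φ M ∧ CBBound M C} := ⟨0, fun _ h => h.1⟩

theorem norm_le_of_cbBound {φ : M0A G} {C : ℝ} (hC : 0 ≤ C) {M : LG G →ₗ[ℂ] LG G}
    (hM : IsMultiplierMap φ M) (h : CBBound M C) : ‖φ‖ ≤ C :=
  csInf_le (bound_bddBelow φ) ⟨hC, M, hM, h⟩

theorem exists_cbBound_of_norm_lt {φ : M0A G} {C : ℝ} (h : ‖φ‖ < C) :
    ∃ M, IsMultiplierMap φ M ∧ CBBound M C := by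
  obtain ⟨D, ⟨-, M, hM, hD⟩, hlt⟩ := exists_lt_of_csInf_lt (bound_nonempty φ) h
  exact ⟨M, hM, hD.mono hlt.le⟩

theorem norm_nonneg' (φ : M0A G) : 0 ≤ ‖φ‖ := le_csInf (bound_nonempty φ) fun _ h => h.1

variable (G) in
theorem exists_norm_ne_zero : ∃ ξ : L2 G, ξ ≠ 0 := by
  obtain ⟨K, hK, hK1⟩ := exists_compact_mem_nhds (1 : G)
  have hne : (interior K).Nonempty := ⟨1, mem_interior_iff_mem_nhds.2 hK1⟩
  have hlt : (Measure.haar : Measure G) (interior K) ≠ ⊤ :=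
    ((measure_mono interior_subset).trans_lt hK.measure_lt_top).ne
  refine ⟨indicatorConstLp 2 isOpen_interior.measurableSet hlt (1 : ℂ), fun h => ?_⟩
  have h1 := norm_indicatorConstLp (μ := (Measure.haar : Measure G)) (p := 2)
    (hs := isOpen_interior.measurableSet) (hμs := hlt) (c := (1 : ℂ)) (by norm_num) (by norm_num)
  rw [h, norm_zero, norm_one, one_mul] at h1
  have h2 : 0 < (Measure.haar : Measure G).real (interior K) :=
    ENNReal.toReal_pos (isOpen_interior.measure_pos _ hne).ne' hlt
  exact (Real.rpow_pos_of_pos h2 _).ne h1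

theorem norm_apply_le_of_cbBound {φ : G → ℂ} {M : LG G →ₗ[ℂ] LG G} {C : ℝ}
    (hM : IsMultiplierMap φ M) (hC : CBBound M C) (g : G) : ‖φ g‖ ≤ C := by
  obtain ⟨ξ, hξ⟩ := exists_norm_ne_zero G
  have h := hC 1 fun _ _ => lam g
  have h2 : (opMatrix fun _ _ : Fin 1 => (M (lam g) : L2 G →L[ℂ] L2 G)) =
      φ g • opMatrix fun _ _ : Fin 1 => (lam g : L2 G →L[ℂ] L2 G) := by
    rw [← opMatrix_smul, hM.map_lam]
    rfl
  rw [h2, norm_smul] at h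
  refine le_of_mul_le_mul_right h (norm_pos_iff.2 fun h0 => hξ ?_)
  have h3 : opMatrix (fun _ _ : Fin 1 => (lam g : L2 G →L[ℂ] L2 G))
      (WithLp.toLp 2 fun _ => ξ) 0 = 0 := by rw [h0]; rfl
  rw [opMatrix_apply] at h3
  have h4 : leftRegular g ξ = 0 := by simpa [lam] using h3
  rw [← norm_eq_zero, norm_leftRegular_apply, norm_eq_zero] at h4
  exact h4

theorem norm_apply_le (φ : M0A G) (g : G) : ‖φ g‖ ≤ ‖φ‖ :=
  le_csInf (bound_nonempty φ) fun _ ⟨_, _, hM, hC⟩ => norm_apply_le_of_cbBound hM hC g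

theorem norm_smul_le' (c : ℂ) (φ : M0A G) : ‖c • φ‖ ≤ ‖c‖ * ‖φ‖ := by
  refine le_of_forall_pos_le_add fun ε hε => ?_
  have hd : 0 < ‖c‖ + 1 := by positivity
  obtain ⟨M, hM, hC⟩ := exists_cbBound_of_norm_lt (lt_add_of_pos_right ‖φ‖ (div_pos hε hd))
  have h1 : ‖c • φ‖ ≤ ‖c‖ * (‖φ‖ + ε / (‖c‖ + 1)) :=
    norm_le_of_cbBound (by have := norm_nonneg' φ; positivity) (hM.smul c) (hC.smul c)
  have h2 : ‖c‖ * (ε / (‖c‖ + 1)) ≤ ε := by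
    rw [mul_div_assoc', div_le_iff₀ hd]
    nlinarith [norm_nonneg c]
  linarith

theorem core : NormedSpace.Core ℂ (M0A G) where
  norm_nonneg := norm_nonneg'
  norm_smul c φ := by
    refine le_antisymm (norm_smul_le' c φ) ?_
    rcases eq_or_ne c 0 with rfl | hc
    · simpa using norm_nonneg' ((0 : ℂ) • φ)
    · have h := norm_smul_le' c⁻¹ (c • φ)
      rw [smul_smul, inv_mul_cancel₀ hc, one_smul, norm_inv] at h
      rwa [← div_eq_inv_mul, le_div_iff₀' (norm_pos_iff.2 hc)] at h
  norm_triangle φ ψ := by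
    refine le_of_forall_pos_le_add fun ε hε => ?_
    obtain ⟨M, hM, hC⟩ := exists_cbBound_of_norm_lt (lt_add_of_pos_right ‖φ‖ (half_pos hε))
    obtain ⟨N, hN, hD⟩ := exists_cbBound_of_norm_lt (lt_add_of_pos_right ‖ψ‖ (half_pos hε))
    have := norm_le_of_cbBound (φ := φ + ψ)
      (by have := norm_nonneg' φ; have := norm_nonneg' ψ; positivity) (hM.add hN) (hC.add hD)
    linarith
  norm_eq_zero_iff φ := by
    constructor
    · intro h
      refine ext fun g => norm_le_zero_iff.1 ?_
      exact (norm_apply_le φ g).trans h.le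
    · rintro rfl
      refine le_antisymm ?_ (norm_nonneg' _)
      have h := norm_smul_le' (0 : ℂ) (0 : M0A G)
      rwa [smul_zero, norm_zero, zero_mul] at h

instance : NormedAddCommGroup (M0A G) := NormedAddCommGroup.ofCore core

instance : NormedSpace ℂ (M0A G) := NormedSpace.ofCore core

theorem continuous_leftRegular_apply (ξ : L2 G) : Continuous fun g : G => leftRegular g ξ := by
  let F : C(G, C(G, G)) := ContinuousMap.curry ⟨fun p : G × G => p.1⁻¹ * p.2, by fun_prop⟩
  exact (continuous_const (y := ξ)).compMeasurePreservingLp F.continuous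
    (fun g => measurePreserving_mul_left Measure.haar g⁻¹) (by norm_num)

theorem continuous_lam : @Continuous G (LG G) _ (ultraweakLG G) lam := by
  let _ := ultraweakTopology (L2 G)
  rw [continuous_induced_rng, continuous_ultraweak_iff]
  intro ξ η
  refine continuous_tsum (fun n => ?_) (summable_norm_mul_norm ξ η) fun n g => ?_
  · exact continuous_const.inner (continuous_leftRegular_apply (ξ n))
  · refine (norm_inner_le_norm _ _).trans_eq ?_
    exact congrArg _ (norm_leftRegular_apply g _)

/-- Completely bounded multipliers are continuous functions. -/
theorem continuous_coe (φ : M0A G) : Continuous (φ : G → ℂ) := by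
  obtain ⟨M, hM, -⟩ := φ.2
  have key : ∀ ξ η : L2 G, Continuous fun g => φ g * inner ℂ η (leftRegular g ξ) := by
    intro ξ η
    let _ := ultraweakLG G
    have h := ((isNormalMap_iff M).1 hM.normal (lp.single 2 0 ξ) (lp.single 2 0 η)).comp
      continuous_lam
    refine h.congr fun g => ?_
    simp only [Function.comp, normalFunctional]
    rw [tsum_eq_single 0, hM.map_lam]
    · simp [lam]
    · intro n hn
      simp [lp.single_apply, hn]
  obtain ⟨ξ, hξ⟩ := exists_norm_ne_zero G
  rw [continuous_iff_continuousAt]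
  intro g₀
  have h1 := (key ξ (leftRegular g₀ ξ)).continuousAt (x := g₀)
  have h2 : Continuous fun g : G => inner ℂ (leftRegular g₀ ξ) (leftRegular g ξ) :=
    continuous_const.inner (continuous_leftRegular_apply ξ)
  have h3 : inner ℂ (leftRegular g₀ ξ) (leftRegular g₀ ξ) ≠ 0 := by
    rw [inner_self_ne_zero, ← norm_ne_zero_iff, norm_leftRegular_apply, norm_ne_zero_iff]
    exact hξ
  refine (h1.div h2.continuousAt h3).congr ?_
  filter_upwards [h2.continuousAt.eventually_ne h3] with g hg
  exact mul_div_cancel_right₀ _ hg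

theorem integrable_mul (f : Lp ℂ 1 (Measure.haar : Measure G)) (φ : M0A G) :
    Integrable (fun g => f g * φ g) (Measure.haar : Measure G) :=
  (L1.integrable_coeFn f).mul_bdd (c := ‖φ‖) (continuous_coe φ).aestronglyMeasurable
    (.of_forall (norm_apply_le φ))

end M0A

variable (G) in
/-- An element `f` of `L¹(G)` as the functional `φ ↦ ∫ f φ` on `M₀A(G)`. -/
def L1toDual : Lp ℂ 1 (Measure.haar : Measure G) →ₗ[ℂ] StrongDual ℂ (M0A G) where
  toFun f := LinearMap.mkContinuous
    { toFun := fun φ => ∫ g, f g * φ g ∂(Measure.haar : Measure G)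
      map_add' := fun φ ψ => by
        simp only [M0A.add_apply, mul_add]
        exact integral_add (M0A.integrable_mul f φ) (M0A.integrable_mul f ψ)
      map_smul' := fun c φ => by
        simp only [M0A.smul_apply, RingHom.id_apply, smul_eq_mul]
        rw [← integral_const_mul]
        congr 1
        ext g
        ring } ‖f‖ (fun φ => by
      change ‖∫ g, f g * φ g ∂(Measure.haar : Measure G)‖ ≤ _
      rw [L1.norm_eq_integral_norm, ← integral_mul_const]
      refine norm_integral_le_of_norm_le ((L1.integrable_coeFn f).norm.mul_const _)
        (.of_forall fun g => ?_)
      rw [norm_mul]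
      gcongr
      exact M0A.norm_apply_le φ g)
  map_add' f f' := by
    ext φ
    change ∫ g, (f + f' : Lp ℂ 1 (Measure.haar : Measure G)) g * φ g ∂(Measure.haar : Measure G) =
      ∫ g, f g * φ g ∂(Measure.haar : Measure G) + ∫ g, f' g * φ g ∂(Measure.haar : Measure G)
    rw [← integral_add (M0A.integrable_mul f φ) (M0A.integrable_mul f' φ)]
    refine integral_congr_ae ?_
    filter_upwards [Lp.coeFn_add f f'] with g hg
    rw [hg, Pi.add_apply, add_mul]
  map_smul' c f := by
    ext φ
    change ∫ g, (c • f : Lp ℂ 1 (Measure.haar : Measure G)) g * φ g ∂(Measure.haar : Measure G) =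
      c • ∫ g, f g * φ g ∂(Measure.haar : Measure G)
    rw [← integral_smul]
    refine integral_congr_ae ?_
    filter_upwards [Lp.coeFn_smul c f] with g hg
    simp [hg, mul_assoc]

theorem L1toDual_apply (f : Lp ℂ 1 (Measure.haar : Measure G)) (φ : M0A G) :
    L1toDual G f φ = ∫ g, f g * φ g ∂(Measure.haar : Measure G) := rfl

variable (G) in
/-- The predual `M₀A(G)_*`: the completion of `L¹(G)` for the norm
`‖f‖ = sup {|⟨f, φ⟩| : ‖φ‖ ≤ 1}`, realised as the closure of `L¹(G)` in the Banach space dual of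
`M₀A(G)`, whose norm restricts to this norm on `L¹(G)`. -/
def predual : Submodule ℂ (StrongDual ℂ (M0A G)) :=
  (LinearMap.range (L1toDual G)).topologicalClosure

variable (G) in
/-- The duality between `M₀A(G)` and `M₀A(G)_*`. -/
def predualPairing : M0A G →ₗ[ℂ] predual G →ₗ[ℂ] ℂ :=
  LinearMap.mk₂ ℂ (fun φ x => (x : StrongDual ℂ (M0A G)) φ)
    (fun φ ψ _ => map_add _ φ ψ) (fun c φ _ => map_smul _ c φ) (fun _ _ _ => rfl)
    (fun _ _ _ => rfl)

/-- Continuity of a linear functional for the weak* topology on `M₀A(G)` defined by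
`M₀A(G)_*`. -/
def IsWeakStarContinuous (m : M0A G →ₗ[ℂ] ℂ) : Prop :=
  Continuous fun φ : WeakBilin (predualPairing G) => m φ

open scoped ComplexOrder in
/-- `m` is a left invariant mean on `M₀A(G)`: a positive linear functional with
`‖m‖ = m(1) = 1`, the norm being the one for the uniform norm on `M₀A(G)`, that is invariant under
left translations. -/
structure IsLeftInvariantMean (m : M0A G →ₗ[ℂ] ℂ) : Prop where
  nonneg : ∀ φ : M0A G, (∀ g, 0 ≤ φ g) → 0 ≤ m φ
  norm_le : ∀ (φ : M0A G) (C : ℝ), (∀ g, ‖φ g‖ ≤ C) → ‖m φ‖ ≤ C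
  map_one : m 1 = 1
  map_translate : ∀ (g : G) (φ : M0A G), m (M0A.translate g φ) = m φ

end Multipliers

/-- Property (T*): `M₀A(G)` has a unique left invariant mean, and this mean is weak* continuous.
The measurable structure on `G` is the Borel one. -/
def PropertyTStar (G : Type*) [Group G] [TopologicalSpace G] [IsTopologicalGroup G]
    [LocallyCompactSpace G] : Prop :=
  letI : MeasurableSpace G := borel G
  haveI : BorelSpace G := ⟨rfl⟩
  ∃ m : M0A G →ₗ[ℂ] ℂ, (IsLeftInvariantMean m ∧ ∀ m', IsLeftInvariantMean m' → m' = m) ∧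
    IsWeakStarContinuous m

end PropTStar

end

/-! The engine is the Hilbert space description of completely bounded multipliers: `‖M_φ‖_cb ≤ C`
holds exactly when `φ (h⁻¹ g) = ⟨Q h, P g⟩` for weakly continuous families `P`, `Q` with `‖P g‖² ≤
C` and `‖Q h‖² ≤ C`. From multiplier to factorization, matrices with entries in `ℂ λ(g)` give a
Schur multiplier inequality (`schur_of_cbBound`), a Riesz extension argument turns it into a Gram
kernel (`exists_factorization`), and compression to closed spans makes the families weakly
continuous (`exists_continuous_factorization`). Conversely, `T ↦ Q* (T ⊗ 1) P` defines the
multiplier map (`exists_isMultiplierMap`). As factorizations can be composed with homomorphisms, `φ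
↦ φ(π(·) k)` is contractive on multipliers for every continuous `π : G → H` and every `k`
(`norm_pullback_le`).

Now let `π` be onto and let `m` be the mean on `G`. The functional `φ ↦ m (φ ∘ π)` is a left
invariant mean on `H`. By uniqueness `m` is also right invariant, so if `f` in `C_c(G)` is within
`ε` of `m` in the predual, then `∫ f(g) φ(π(g) h) dg` is within `ε ‖φ‖` of `t = m (φ ∘ π)` for every
`h` in `H` at once (`norm_sub_integral_le`). Both remaining claims follow from this uniform
estimate.

Weak* continuity: averaging in `h` against a bump `u` of integral one replaces the push-forward of
`f dg`, which need not have a density, by a function in `C_c(H)`. No relation between the Haar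
measures of `G` and `H` is needed.

Uniqueness: a left invariant mean `m'` on `H` is contractive for the uniform norm. The average `∫
f(g) φ(π(g) ·) dg` is a uniform limit of combinations of left translates of `φ` whose coefficients
sum to nearly `∫ f`, hence nearly `m 1 = 1` (`exists_translate_combination`). So `m'` takes nearly
the value `m' φ` on these combinations, which are uniformly close to the constant `t`; hence `m' φ =
t`. -/

noncomputable section

namespace PropTStar

open scoped ComplexConjugate

universe u

/-! ### Gram kernels and factorization of Schur multipliers -/

section Kernel

/-- A positive semidefinite kernel is the Gram kernel of a family in a Hilbert space. -/
theorem exists_gram_of_kernel {X : Type u} (Z : X → X → ℂ) (hZ : ∀ x y, conj (Z x y) = Z y x)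
    (hpos : ∀ f : X →₀ ℂ,
      0 ≤ (f.sum fun x a => f.sum fun y b => conj a * b * Z x y).re) :
    ∃ (K : Type u) (_ : NormedAddCommGroup K) (_ : InnerProductSpace ℂ K) (_ : CompleteSpace K)
      (v : X → K), ∀ x y, inner ℂ (v x) (v y) = Z x y := by
  let core : PreInnerProductSpace.Core ℂ (X →₀ ℂ) :=
    { inner := fun f g => f.sum fun x a => g.sum fun y b => conj a * b * Z x y
      conj_inner_symm := fun f g => by
        rw [Finsupp.sum_comm]
        simp only [map_finsuppSum, map_mul, hZ, Complex.conj_conj]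
        simp only [mul_comm]
      re_inner_nonneg := hpos
      add_left := fun f g h => by
        rw [Finsupp.sum_add_index'] <;> simp [add_mul]
      smul_left := fun f g c => by
        rw [Finsupp.sum_smul_index] <;> simp [Finsupp.mul_sum, mul_assoc] }
  let _ : SeminormedAddCommGroup (X →₀ ℂ) :=
    InnerProductSpace.Core.toSeminormedAddCommGroup (𝕜 := ℂ) (c := core)
  let _ : InnerProductSpace ℂ (X →₀ ℂ) := InnerProductSpace.ofCore core
  -- The form may be degenerate; the completion is separated, so it also divides out the null
  -- vectors.
  refine ⟨UniformSpace.Completion (X →₀ ℂ), inferInstance, inferInstance, inferInstance,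
    fun x => ((Finsupp.single x 1 : X →₀ ℂ) : UniformSpace.Completion (X →₀ ℂ)), fun x y => ?_⟩
  rw [UniformSpace.Completion.inner_coe]
  change ((Finsupp.single x (1 : ℂ)).sum fun x a =>
    (Finsupp.single y (1 : ℂ)).sum fun y b => conj a * b * Z x y) = Z x y
  simp

theorem linearCombination_eq_sum_disjSum {ι : Type*} [DecidableEq ι] (k : (ι ⊕ ι) × (ι ⊕ ι) → ℂ)
    (B : (ι ⊕ ι) × (ι ⊕ ι) →₀ ℂ) (F : Finset ι)
    (hF : ∀ p ∈ B.support, p ∈ (F.disjSum F) ×ˢ (F.disjSum F)) :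
    Finsupp.linearCombination ℂ k B =
      ∑ x ∈ F.disjSum F, ∑ y ∈ F.disjSum F, B (x, y) * k (x, y) := by
  rw [Finsupp.linearCombination_apply, Finsupp.sum_of_support_subset (s := (F.disjSum F) ×ˢ
    (F.disjSum F)) _ hF _ (by simp), Finset.sum_product]
  rfl

/-- The block matrices both of whose diagonal blocks are diagonal. -/
def blockDiagonal (ι : Type*) : Submodule ℝ ((ι ⊕ ι) × (ι ⊕ ι) →₀ ℂ) where
  carrier := {B | ∀ i j, i ≠ j → B (.inl i, .inl j) = 0 ∧ B (.inr i, .inr j) = 0}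
  add_mem' hA hB i j h := by simp [hA i j h, hB i j h]
  zero_mem' := by simp
  smul_mem' c B hB i j h := by simp [hB i j h]

/-- The matrices whose quadratic form has nonnegative real part. -/
def accretiveCone (X : Type*) : PointedCone ℝ (X × X →₀ ℂ) where
  carrier := {B | ∀ t : X → ℂ,
    0 ≤ (Finsupp.linearCombination ℂ (fun p : X × X => conj (t p.1) * t p.2) B).re}
  add_mem' hA hB t := by simpa using add_nonneg (hA t) (hB t)
  zero_mem' := by simp
  smul_mem' c B hB t := by
    have : Finsupp.linearCombination ℂ (fun p : X × X => conj (t p.1) * t p.2) (c • B) =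
        (c : ℝ) • Finsupp.linearCombination ℂ (fun p : X × X => conj (t p.1) * t p.2) B :=
      ((Finsupp.linearCombination ℂ _).restrictScalars ℝ).map_smul (c : ℝ) B
    rw [this, Complex.smul_re]
    exact mul_nonneg c.2 (hB t)

/-- A Hermitian `k` is real on the diagonal, and conjugation folds the lower left block onto the
upper right one. This brings the pairing into the shape used in the hypothesis of
`exists_factorization`. -/
theorem re_linearCombination_of_mem_blockDiagonal {ι : Type*} [DecidableEq ι]
    (k : (ι ⊕ ι) × (ι ⊕ ι) → ℂ) (hk : ∀ x y, conj (k (x, y)) = k (y, x))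
    (B : (ι ⊕ ι) × (ι ⊕ ι) →₀ ℂ) (hB : B ∈ blockDiagonal ι) (F : Finset ι)
    (hF : ∀ p ∈ B.support, p ∈ (F.disjSum F) ×ˢ (F.disjSum F)) :
    (Finsupp.linearCombination ℂ k B).re =
      ∑ i ∈ F, (B (.inl i, .inl i)).re * (k (.inl i, .inl i)).re +
      ∑ i ∈ F, (B (.inr i, .inr i)).re * (k (.inr i, .inr i)).re +
      (∑ i ∈ F, ∑ j ∈ F, (B (.inl i, .inr j) + conj (B (.inr j, .inl i))) *
        k (.inl i, .inr j)).re := by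
  have him : ∀ x, (k (x, x)).im = 0 := fun x => Complex.conj_eq_iff_im.1 (hk x x)
  have h1 : ∀ i ∈ F, ∑ j ∈ F, B (.inl i, .inl j) * k (.inl i, .inl j) =
      B (.inl i, .inl i) * k (.inl i, .inl i) := fun i hi =>
    Finset.sum_eq_single_of_mem i hi fun j _ hj => by rw [(hB i j hj.symm).1, zero_mul]
  have h2 : ∀ i ∈ F, ∑ j ∈ F, B (.inr i, .inr j) * k (.inr i, .inr j) =
      B (.inr i, .inr i) * k (.inr i, .inr i) := fun i hi =>
    Finset.sum_eq_single_of_mem i hi fun j _ hj => by rw [(hB i j hj.symm).2, zero_mul]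
  have h3 : (∑ i ∈ F, ∑ j ∈ F, B (.inr i, .inl j) * k (.inr i, .inl j)).re =
      (∑ i ∈ F, ∑ j ∈ F, conj (B (.inr j, .inl i)) * k (.inl i, .inr j)).re := by
    rw [Finset.sum_comm]
    simp only [Complex.re_sum]
    refine Finset.sum_congr rfl fun i _ => Finset.sum_congr rfl fun j _ => ?_
    rw [← hk, ← Complex.conj_re]
    simp
  rw [linearCombination_eq_sum_disjSum k B F hF]
  simp only [Finset.sum_disjSum, Finset.sum_add_distrib, add_mul]
  rw [Finset.sum_congr rfl h1, Finset.sum_congr rfl h2]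
  simp only [Complex.add_re, h3]
  simp only [Complex.re_sum, Complex.mul_re, him]
  simp
  ring

/-- A Schur multiplier factors through a Hilbert space. The hypothesis is the dual formulation of
boundedness of the Schur multiplier `φ`. -/
theorem exists_factorization {ι : Type u} (φ : ι → ι → ℂ) (C : ℝ)
    (h : ∀ (F : Finset ι) (c : ι → ι → ℂ) (d e : ι → ℝ),
      (∀ s t : ι → ℂ, 0 ≤ ∑ i ∈ F, d i * ‖s i‖ ^ 2 + ∑ i ∈ F, e i * ‖t i‖ ^ 2 +
        (∑ i ∈ F, ∑ j ∈ F, c i j * (conj (s i) * t j)).re) →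
      0 ≤ ∑ i ∈ F, d i * C + ∑ i ∈ F, e i * C + (∑ i ∈ F, ∑ j ∈ F, c i j * φ i j).re) :
    ∃ (K : Type u) (_ : NormedAddCommGroup K) (_ : InnerProductSpace ℂ K) (_ : CompleteSpace K)
      (P Q : ι → K), (∀ i j, inner ℂ (Q i) (P j) = φ i j) ∧ (∀ i, ‖P i‖ ^ 2 = C) ∧
        ∀ i, ‖Q i‖ ^ 2 = C := by
  classical
  -- The zeros off the diagonal of the two diagonal blocks are placeholders: `blockDiagonal` never
  -- sees them, and the extension chooses the true values.
  let Φ : (ι ⊕ ι) × (ι ⊕ ι) → ℂ := fun p => match p with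
    | (.inl i, .inl j) => if i = j then C else 0
    | (.inr i, .inr j) => if i = j then C else 0
    | (.inl i, .inr j) => φ i j
    | (.inr i, .inl j) => conj (φ j i)
  have hΦ : ∀ x y, conj (Φ (x, y)) = Φ (y, x) := by
    rintro (i | i) (j | j) <;> simp only [Φ, Complex.conj_conj]
    all_goals by_cases hij : i = j <;> simp [hij, eq_comm]
  let f₀ : ((ι ⊕ ι) × (ι ⊕ ι) →₀ ℂ) →ₗ[ℝ] ℝ :=
    Complex.reLm ∘ₗ (Finsupp.linearCombination ℂ Φ).restrictScalars ℝ
  let f : ((ι ⊕ ι) × (ι ⊕ ι) →₀ ℂ) →ₗ.[ℝ] ℝ := ⟨blockDiagonal ι, f₀ ∘ₗ (blockDiagonal ι).subtype⟩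
  have hsq : ∀ z : ℂ, (conj z * z).re = ‖z‖ ^ 2 := fun z => by
    rw [mul_comm, Complex.mul_conj, Complex.normSq_eq_norm_sq, Complex.ofReal_re]
  have hnonneg : ∀ x : f.domain, (x : (ι ⊕ ι) × (ι ⊕ ι) →₀ ℂ) ∈ accretiveCone (ι ⊕ ι) →
      0 ≤ f x := by
    rintro ⟨B, hB⟩ hs
    let T : Finset (ι ⊕ ι) := B.support.image Prod.fst ∪ B.support.image Prod.snd
    let F : Finset ι := T.image (Sum.elim id id)
    have hT : T ⊆ F.disjSum F := by
      rintro (i | i) hi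
      · exact Finset.inl_mem_disjSum.2 (Finset.mem_image_of_mem (Sum.elim id id) hi)
      · exact Finset.inr_mem_disjSum.2 (Finset.mem_image_of_mem (Sum.elim id id) hi)
    have hF : ∀ p ∈ B.support, p ∈ (F.disjSum F) ×ˢ (F.disjSum F) := fun p hp =>
      Finset.mem_product.2 ⟨hT (Finset.mem_union_left _ (Finset.mem_image_of_mem _ hp)),
        hT (Finset.mem_union_right _ (Finset.mem_image_of_mem _ hp))⟩
    change 0 ≤ (Finsupp.linearCombination ℂ Φ B).re
    rw [re_linearCombination_of_mem_blockDiagonal Φ hΦ B hB F hF]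
    have key := h F (fun i j => B (.inl i, .inr j) + conj (B (.inr j, .inl i)))
      (fun i => (B (.inl i, .inl i)).re) (fun i => (B (.inr i, .inr i)).re) fun s t => by
        have := hs (Sum.elim s t)
        rw [re_linearCombination_of_mem_blockDiagonal _
          (fun x y => by simp [mul_comm]) B hB F hF] at this
        simpa only [Sum.elim_inl, Sum.elim_inr, hsq] using this
    simpa [Φ] using key
  -- The domination condition of the Riesz extension theorem: an entry `c` at `(x, y)` is absorbed
  -- by `‖c‖` at `(x, x)` and at `(y, y)`.
  have hdense : ∀ y, ∃ x : f.domain,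
      (x : (ι ⊕ ι) × (ι ⊕ ι) →₀ ℂ) + y ∈ accretiveCone (ι ⊕ ι) := by
    intro y
    induction y using Finsupp.induction_linear with
    | zero => exact ⟨0, by simp⟩
    | add a b ha hb =>
      obtain ⟨x, hx⟩ := ha
      obtain ⟨x', hx'⟩ := hb
      refine ⟨x + x', ?_⟩
      have := (accretiveCone (ι ⊕ ι)).add_mem hx hx'
      rwa [add_add_add_comm] at this
    | single p c =>
      obtain ⟨x, y⟩ := p
      refine ⟨⟨Finsupp.single (x, x) (‖c‖ : ℂ) + Finsupp.single (y, y) (‖c‖ : ℂ), ?_⟩, ?_⟩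
      · have : ∀ z : ι ⊕ ι, Finsupp.single (z, z) (‖c‖ : ℂ) ∈ blockDiagonal ι := by
          rintro (z | z) i j hij <;> simp [Finsupp.single_apply] <;> grind
        exact (blockDiagonal ι).add_mem (this x) (this y)
      · intro t
        simp only [map_add, Finsupp.linearCombination_single, smul_eq_mul, Complex.add_re,
          Complex.re_ofReal_mul, hsq]
        have h1 : |(c * (conj (t x) * t y)).re| ≤ ‖c‖ * (‖t x‖ * ‖t y‖) := by
          refine (Complex.abs_re_le_norm _).trans_eq ?_
          simp
        have h2 := neg_abs_le (c * (conj (t x) * t y)).re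
        nlinarith [norm_nonneg c, sq_nonneg (‖t x‖ - ‖t y‖), sq_nonneg (‖t x‖ + ‖t y‖),
          mul_nonneg (norm_nonneg c) (sq_nonneg (‖t x‖ - ‖t y‖)),
          mul_nonneg (norm_nonneg c) (sq_nonneg (‖t x‖)),
          mul_nonneg (norm_nonneg c) (sq_nonneg (‖t y‖))]
  obtain ⟨g, hg, hgpos⟩ := riesz_extension (accretiveCone (ι ⊕ ι)) f hnonneg hdense
  -- The complex kernel whose real part gives back the real functional `g`.
  let Z : ι ⊕ ι → ι ⊕ ι → ℂ := fun x y =>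
    (g (Finsupp.single (x, y) 1) : ℂ) - Complex.I * g (Finsupp.single (x, y) Complex.I)
  have hZre : ∀ x y w, (w * Z x y).re = g (Finsupp.single (x, y) w) := by
    intro x y w
    have : (Finsupp.single (x, y) w : (ι ⊕ ι) × (ι ⊕ ι) →₀ ℂ) =
        w.re • Finsupp.single (x, y) 1 + w.im • Finsupp.single (x, y) Complex.I := by
      rw [Finsupp.smul_single, Finsupp.smul_single, ← Finsupp.single_add]
      congr 1
      simp [Complex.re_add_im]
    rw [this, map_add, map_smul, map_smul]
    simp [Z]
  -- The difference of the two matrices has a purely imaginary quadratic form, so it lies in the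
  -- cone together with its negative and `g` kills it.
  have hZherm : ∀ x y w, g (Finsupp.single (x, y) w) = g (Finsupp.single (y, x) (conj w)) := by
    intro x y w
    have h0 : ∀ t : ι ⊕ ι → ℂ, (Finsupp.linearCombination ℂ
        (fun p : (ι ⊕ ι) × (ι ⊕ ι) => conj (t p.1) * t p.2)
        (Finsupp.single (x, y) w - Finsupp.single (y, x) (conj w))).re = 0 := fun t => by
      simp only [map_sub, Finsupp.linearCombination_single, smul_eq_mul, Complex.sub_re]
      rw [sub_eq_zero, ← Complex.conj_re]
      congr 1
      simp only [map_mul, Complex.conj_conj]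
      ring
    have h1 := hgpos (Finsupp.single (x, y) w - Finsupp.single (y, x) (conj w))
      fun t => (h0 t).ge
    have h2 := hgpos (-(Finsupp.single (x, y) w - Finsupp.single (y, x) (conj w)))
      fun t => by rw [map_neg, Complex.neg_re, h0, neg_zero]
    rw [map_neg] at h2
    rw [map_sub] at h1 h2
    linarith
  obtain ⟨K, i1, i2, i3, v, hv⟩ := exists_gram_of_kernel Z
    (fun x y => by
      have h1 := hZherm x y 1
      have h2 := hZherm x y Complex.I
      rw [Complex.conj_I, Finsupp.single_neg, map_neg] at h2
      rw [map_one] at h1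
      simp [Z, h1, h2, sub_eq_add_neg])
    (fun a => by
      have : (a.sum fun x u => a.sum fun y w => conj u * w * Z x y).re =
          g (a.sum fun x u => a.sum fun y w => Finsupp.single (x, y) (conj u * w)) := by
        simp only [Finsupp.sum, Complex.re_sum, map_sum, hZre]
      rw [this]
      refine hgpos _ fun t => ?_
      simp only [Finsupp.sum, map_sum, Finsupp.linearCombination_single, smul_eq_mul]
      have : ∑ x ∈ a.support, ∑ y ∈ a.support, conj (a x) * a y * (conj (t x) * t y) =
          conj (∑ x ∈ a.support, a x * t x) * ∑ x ∈ a.support, a x * t x := by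
        rw [map_sum, Finset.sum_mul_sum]
        refine Finset.sum_congr rfl fun x _ => Finset.sum_congr rfl fun y _ => ?_
        simp only [map_mul]
        ring
      rw [this, hsq]
      positivity)
  have hval : ∀ x y, (∀ w, Finsupp.single (x, y) w ∈ blockDiagonal ι) → Z x y = Φ (x, y) := by
    intro x y hxy
    have h1 : ∀ w, g (Finsupp.single (x, y) w) = (w * Φ (x, y)).re := fun w => by
      rw [hg ⟨_, hxy w⟩]
      change (Finsupp.linearCombination ℂ Φ _).re = _
      simp
    apply Complex.ext <;> simp [Z, h1]
  have hdiag : ∀ z : ι ⊕ ι, ∀ w, Finsupp.single (z, z) w ∈ blockDiagonal ι := by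
    rintro (z | z) w i j hij <;> simp [Finsupp.single_apply] <;> grind
  have hnorm : ∀ z, ‖v z‖ ^ 2 = C := fun z => by
    have h1 := hv z z
    rw [hval z z (hdiag z), inner_self_eq_norm_sq_to_K] at h1
    rcases z with z | z <;> simp only [Φ, if_true] at h1 <;>
      exact Complex.ofReal_injective (by rw [← h1]; simp)
  refine ⟨K, i1, i2, i3, fun j => v (.inr j), fun i => v (.inl i), fun i j => ?_,
    fun i => hnorm _, fun i => hnorm _⟩
  rw [hv, hval]
  intro w i' j' _
  simp
end Kernel

/-! ### From complete boundedness to the Schur multiplier inequality -/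

section Schur

/-- Positivity of a scalar form in `2n` variables passes to vectors of a Hilbert space. -/
theorem nonneg_form_of_scalar {ι E : Type*} [NormedAddCommGroup E] [InnerProductSpace ℂ E]
    [CompleteSpace E] (F : Finset ι) (c : ι → ι → ℂ) (d e : ι → ℝ)
    (h : ∀ s t : ι → ℂ, 0 ≤ ∑ i ∈ F, d i * ‖s i‖ ^ 2 + ∑ i ∈ F, e i * ‖t i‖ ^ 2 +
        (∑ i ∈ F, ∑ j ∈ F, c i j * (conj (s i) * t j)).re) (s t : ι → E) :
    0 ≤ ∑ i ∈ F, d i * ‖s i‖ ^ 2 + ∑ i ∈ F, e i * ‖t i‖ ^ 2 +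
        (∑ i ∈ F, ∑ j ∈ F, c i j * inner ℂ (s i) (t j)).re := by
  -- The scalar inequality is applied to each coordinate and summed over a Hilbert basis.
  obtain ⟨w, b, -⟩ := exists_hilbertBasis ℂ E
  have hn : ∀ x : E, HasSum (fun k => ‖inner ℂ (b k) x‖ ^ 2) (‖x‖ ^ 2) := fun x => by
    have h1 := Complex.hasSum_re (b.hasSum_inner_mul_inner x x)
    have h2 : ∀ k, (inner ℂ x (b k) * inner ℂ (b k) x).re = ‖inner ℂ (b k) x‖ ^ 2 := fun k => by
      rw [← inner_conj_symm x (b k), mul_comm, Complex.mul_conj, Complex.ofReal_re,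
        Complex.normSq_eq_norm_sq]
    have h3 : (inner ℂ x x : ℂ).re = ‖x‖ ^ 2 := inner_self_eq_norm_sq (𝕜 := ℂ) x
    rw [h3] at h1
    exact h1.congr_fun fun k => (h2 k).symm
  refine HasSum.nonneg (L := .unconditional _)
    (fun k => h (fun i => inner ℂ (b k) (s i)) fun j => inner ℂ (b k) (t j)) ?_
  refine ((hasSum_sum fun i _ => (hn (s i)).mul_left _).add
    (hasSum_sum fun i _ => (hn (t i)).mul_left _)).add (Complex.hasSum_re ?_)
  refine hasSum_sum fun i _ => hasSum_sum fun j _ => HasSum.mul_left _ ?_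
  simp only [inner_conj_symm]
  exact b.hasSum_inner_mul_inner (s i) (t j)

variable {G : Type*} [Group G] [TopologicalSpace G] [IsTopologicalGroup G]
  [LocallyCompactSpace G] [MeasurableSpace G] [BorelSpace G]

theorem inner_leftRegular_inv_mul (g h : G) (ξ η : L2 G) :
    inner ℂ η (leftRegular (g⁻¹ * h) ξ) = inner ℂ (leftRegular g η) (leftRegular h ξ) := by
  rw [leftRegular_mul, mul_apply_eq_comp, inner_leftRegular, inv_inv]

theorem inner_opMatrix {H : Type*} [NormedAddCommGroup H] [InnerProductSpace ℂ H] {n : ℕ}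
    (x : Fin n → Fin n → (H →L[ℂ] H)) (w v : PiLp 2 (fun _ : Fin n => H)) :
    inner ℂ w (opMatrix x v) = ∑ i, ∑ j, inner ℂ (w i) (x i j (v j)) := by
  simp only [PiLp.inner_apply, opMatrix_apply, inner_sum]

/-- Positivity of the form says that the matrix `c i j / (2 √(d i) √(e j))` is a contraction.
Twisting its entries by `λ(hᵢ⁻¹ hⱼ)` is conjugation by a diagonal unitary and preserves this; `M`
then inserts the factors `φ(hᵢ⁻¹ hⱼ)` at the cost of `C`, and suitable vectors recover the scalar
sum. -/
theorem schur_of_pos {φ : G → ℂ} {M : LG G →ₗ[ℂ] LG G} {C : ℝ} (hM : IsMultiplierMap φ M)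
    (hC : CBBound M C) (hC0 : 0 ≤ C) {n : ℕ} (h : Fin n → G) (c : Fin n → Fin n → ℂ)
    (d e : Fin n → ℝ) (hd : ∀ i, 0 < d i) (he : ∀ i, 0 < e i)
    (hpos : ∀ s t : Fin n → ℂ, 0 ≤ ∑ i, d i * ‖s i‖ ^ 2 + ∑ i, e i * ‖t i‖ ^ 2 +
        (∑ i, ∑ j, c i j * (conj (s i) * t j)).re) :
    0 ≤ ∑ i, d i * C + ∑ i, e i * C + (∑ i, ∑ j, c i j * φ ((h i)⁻¹ * h j)).re := by
  have hd' : ∀ i, (√(d i) : ℂ) ≠ 0 := fun i => by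
    simpa using (Real.sqrt_pos.2 (hd i)).ne'
  have he' : ∀ i, (√(e i) : ℂ) ≠ 0 := fun i => by
    simpa using (Real.sqrt_pos.2 (he i)).ne'
  let a : Fin n → Fin n → ℂ := fun i j => c i j / (2 * √(d i) * √(e j))
  let x : Fin n → Fin n → LG G := fun i j => a i j • lam ((h i)⁻¹ * h j)
  have hx : ‖opMatrix fun i j => (x i j : L2 G →L[ℂ] L2 G)‖ ≤ 1 := by
    refine ContinuousLinearMap.opNorm_le_bound _ zero_le_one fun v => ?_
    rw [one_mul]
    set w := opMatrix (fun i j => (x i j : L2 G →L[ℂ] L2 G)) v with hw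
    -- With `w = x v`, these vectors turn the form into `‖w‖² + ‖v‖² - 2 ‖w‖²`, whence `‖w‖ ≤ ‖v‖`.
    have key := nonneg_form_of_scalar Finset.univ c d e hpos
      (fun i => -((√(d i) : ℂ)⁻¹ • leftRegular (h i) (w i)))
      (fun i => (√(e i) : ℂ)⁻¹ • leftRegular (h i) (v i))
    have h1 : ∑ i, d i * ‖-((√(d i) : ℂ)⁻¹ • leftRegular (h i) (w i))‖ ^ 2 = ‖w‖ ^ 2 := by
      rw [PiLp.norm_sq_eq_of_L2]
      refine Finset.sum_congr rfl fun i _ => ?_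
      rw [norm_neg, norm_smul, norm_leftRegular_apply, mul_pow, norm_inv, Complex.norm_real,
        Real.norm_eq_abs, inv_pow, sq_abs, Real.sq_sqrt (hd i).le,
        mul_inv_cancel_left₀ (hd i).ne']
    have h2 : ∑ i, e i * ‖(√(e i) : ℂ)⁻¹ • leftRegular (h i) (v i)‖ ^ 2 = ‖v‖ ^ 2 := by
      rw [PiLp.norm_sq_eq_of_L2]
      refine Finset.sum_congr rfl fun i _ => ?_
      rw [norm_smul, norm_leftRegular_apply, mul_pow, norm_inv, Complex.norm_real,
        Real.norm_eq_abs, inv_pow, sq_abs, Real.sq_sqrt (he i).le,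
        mul_inv_cancel_left₀ (he i).ne']
    have h3 : ∑ i, ∑ j, c i j * inner ℂ (-((√(d i) : ℂ)⁻¹ • leftRegular (h i) (w i)))
        ((√(e j) : ℂ)⁻¹ • leftRegular (h j) (v j)) = -(2 * inner ℂ w w) := by
      conv_rhs => rw [hw, ← hw, inner_opMatrix]
      rw [Finset.mul_sum, ← Finset.sum_neg_distrib]
      refine Finset.sum_congr rfl fun i _ => ?_
      rw [Finset.mul_sum, ← Finset.sum_neg_distrib]
      refine Finset.sum_congr rfl fun j _ => ?_
      change _ = -(2 * inner ℂ (w i) (a i j • leftRegular ((h i)⁻¹ * h j) (v j)))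
      rw [inner_neg_left, inner_smul_left, inner_smul_right, inner_smul_right,
        inner_leftRegular_inv_mul]
      have := hd' i
      have := he' j
      simp only [a, map_inv₀, Complex.conj_ofReal]
      field_simp
    rw [h1, h2, h3, inner_self_eq_norm_sq_to_K] at key
    have h4 : (-(2 * ((‖w‖ : ℂ)) ^ 2)).re = -(2 * ‖w‖ ^ 2) := by
      rw [← Complex.ofReal_re (-(2 * ‖w‖ ^ 2))]
      push_cast
      rfl
    have h5 : 0 ≤ ‖w‖ ^ 2 + ‖v‖ ^ 2 + -(2 * ‖w‖ ^ 2) := by rw [← h4]; exact key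
    exact le_of_sq_le_sq (by linarith) (norm_nonneg v)
  obtain ⟨ξ₀, hξ₀⟩ := M0A.exists_norm_ne_zero G
  obtain ⟨ξ, hξ⟩ : ∃ ξ : L2 G, ‖ξ‖ = 1 := ⟨(‖ξ₀‖ : ℂ)⁻¹ • ξ₀, by
    rw [norm_smul, norm_inv, Complex.norm_real, norm_norm,
      inv_mul_cancel₀ (norm_ne_zero_iff.2 hξ₀)]⟩
  -- The translations in `v` and `w` cancel those of the matrix entries, and the weights cancel the
  -- normalization of `a`.
  let v : PiLp 2 (fun _ : Fin n => L2 G) :=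
    WithLp.toLp 2 fun j => (√(e j) : ℂ) • leftRegular (h j)⁻¹ ξ
  let w : PiLp 2 (fun _ : Fin n => L2 G) :=
    WithLp.toLp 2 fun j => (√(d j) : ℂ) • leftRegular (h j)⁻¹ ξ
  have hv : ‖v‖ ^ 2 = ∑ i, e i := by
    rw [PiLp.norm_sq_eq_of_L2]
    refine Finset.sum_congr rfl fun i _ => ?_
    change ‖(√(e i) : ℂ) • leftRegular (h i)⁻¹ ξ‖ ^ 2 = _
    rw [norm_smul, norm_leftRegular_apply, hξ, mul_one, Complex.norm_real, Real.norm_eq_abs, sq_abs,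
      Real.sq_sqrt (he i).le]
  have hw : ‖w‖ ^ 2 = ∑ i, d i := by
    rw [PiLp.norm_sq_eq_of_L2]
    refine Finset.sum_congr rfl fun i _ => ?_
    change ‖(√(d i) : ℂ) • leftRegular (h i)⁻¹ ξ‖ ^ 2 = _
    rw [norm_smul, norm_leftRegular_apply, hξ, mul_one, Complex.norm_real, Real.norm_eq_abs, sq_abs,
      Real.sq_sqrt (hd i).le]
  have h1 := (hC n x).trans (mul_le_of_le_one_right hC0 hx)
  have h2 : inner ℂ w (opMatrix (fun i j => (M (x i j) : L2 G →L[ℂ] L2 G)) v) =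
      (∑ i, ∑ j, c i j * φ ((h i)⁻¹ * h j)) / 2 := by
    rw [inner_opMatrix, Finset.sum_div]
    refine Finset.sum_congr rfl fun i _ => ?_
    rw [Finset.sum_div]
    refine Finset.sum_congr rfl fun j _ => ?_
    have h3 : M (x i j) = a i j • φ ((h i)⁻¹ * h j) • lam ((h i)⁻¹ * h j) := by
      rw [← hM.map_lam, map_smul]
    rw [h3]
    change inner ℂ ((√(d i) : ℂ) • leftRegular (h i)⁻¹ ξ) (a i j • φ ((h i)⁻¹ * h j) •
      leftRegular ((h i)⁻¹ * h j) ((√(e j) : ℂ) • leftRegular (h j)⁻¹ ξ)) = _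
    rw [map_smul, inner_smul_left, inner_smul_right, inner_smul_right, inner_smul_right,
      inner_leftRegular_inv_mul, leftRegular_inv_apply, leftRegular_inv_apply,
      inner_self_eq_norm_sq_to_K, hξ]
    have := hd' i
    have := he' j
    simp only [a, Complex.conj_ofReal]
    field_simp
    simp
  have h3 := (norm_inner_le_norm (𝕜 := ℂ) w _).trans (mul_le_mul_of_nonneg_left
    ((ContinuousLinearMap.le_of_opNorm_le _ h1 v)) (norm_nonneg w))
  rw [h2] at h3
  have h4 := neg_le_of_abs_le ((Complex.abs_re_le_norm _).trans h3)
  have h5 : ((∑ i, ∑ j, c i j * φ ((h i)⁻¹ * h j)) / 2).re =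
      (∑ i, ∑ j, c i j * φ ((h i)⁻¹ * h j)).re / 2 := by simp
  rw [h5] at h4
  rw [← Finset.sum_mul, ← Finset.sum_mul, ← hv, ← hw]
  -- Arithmetic-geometric mean: `2 ‖v‖ ‖w‖ ≤ ‖v‖² + ‖w‖² = ∑ e + ∑ d`.
  nlinarith [mul_nonneg hC0 (sq_nonneg (‖v‖ - ‖w‖))]

/-- Testing the form on unit vectors shows that the weights are nonnegative on `F`; adding `δ > 0`
to each of them reduces to `schur_of_pos`. -/
theorem schur_of_cbBound {φ : G → ℂ} {M : LG G →ₗ[ℂ] LG G} {C : ℝ} (hM : IsMultiplierMap φ M)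
    (hC : CBBound M C) (F : Finset G) (c : G → G → ℂ) (d e : G → ℝ)
    (hpos : ∀ s t : G → ℂ, 0 ≤ ∑ i ∈ F, d i * ‖s i‖ ^ 2 + ∑ i ∈ F, e i * ‖t i‖ ^ 2 +
        (∑ i ∈ F, ∑ j ∈ F, c i j * (conj (s i) * t j)).re) :
    0 ≤ ∑ i ∈ F, d i * C + ∑ i ∈ F, e i * C + (∑ i ∈ F, ∑ j ∈ F, c i j * φ (i⁻¹ * j)).re := by
  classical
  have hC0 : 0 ≤ C := (norm_nonneg _).trans (M0A.norm_apply_le_of_cbBound hM hC 1)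
  have hd : ∀ i ∈ F, 0 ≤ d i := fun i hi => by
    have := hpos (Pi.single i 1) 0
    simpa [Pi.single_apply, apply_ite, hi] using this
  have he : ∀ i ∈ F, 0 ≤ e i := fun i hi => by
    have := hpos 0 (Pi.single i 1)
    simpa [Pi.single_apply, apply_ite, hi] using this
  let q := F.equivFin.symm
  have hsum : ∀ {A : Type} [AddCommMonoid A] (f : G → A), ∑ i ∈ F, f i = ∑ k, f (q k) :=
    fun f => by rw [← Finset.sum_coe_sort, ← q.sum_comp]
  refine le_of_forall_pos_le_add fun ε hε => ?_
  -- Raising all `2 |F|` weights by `δ` costs `2 |F| δ C ≤ ε`.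
  set δ : ℝ := ε / (2 * (F.card * C + 1)) with hδ
  have hden : 0 < 2 * (F.card * C + 1) := by positivity
  have hδ0 : 0 < δ := by positivity
  have key := schur_of_pos hM hC hC0 (fun k => (q k : G)) (fun k l => c (q k) (q l))
    (fun k => d (q k) + δ) (fun k => e (q k) + δ)
    (fun k => add_pos_of_nonneg_of_pos (hd _ (q k).2) hδ0)
    (fun k => add_pos_of_nonneg_of_pos (he _ (q k).2) hδ0) fun s t => by
      have h1 := hpos (fun g => if hg : g ∈ F then s (q.symm ⟨g, hg⟩) else 0)
        (fun g => if hg : g ∈ F then t (q.symm ⟨g, hg⟩) else 0)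
      simp only [hsum] at h1
      simp only [Subtype.coe_eta, Equiv.symm_apply_apply, Finset.coe_mem, dite_true] at h1
      refine h1.trans ?_
      gcongr <;> linarith
  simp only [hsum]
  simp only [add_mul, Finset.sum_add_distrib, Finset.sum_const, Finset.card_univ,
    Fintype.card_fin, nsmul_eq_mul] at key
  have h2 : 2 * (F.card * (δ * C)) ≤ ε := by
    have : δ * (2 * (F.card * C + 1)) = ε := div_mul_cancel₀ _ hden.ne'
    nlinarith
  linarith

end Schur

/-! ### Weakly continuous factorizations -/

section Factorization

variable {G : Type u} [Group G] [TopologicalSpace G] [IsTopologicalGroup G]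
  [LocallyCompactSpace G] [MeasurableSpace G] [BorelSpace G]

theorem exists_factorization_of_cbBound {φ : G → ℂ} {M : LG G →ₗ[ℂ] LG G} {C : ℝ}
    (hM : IsMultiplierMap φ M) (hC : CBBound M C) :
    ∃ (K : Type u) (_ : NormedAddCommGroup K) (_ : InnerProductSpace ℂ K) (_ : CompleteSpace K)
      (P Q : G → K), (∀ g h, inner ℂ (Q h) (P g) = φ (h⁻¹ * g)) ∧ (∀ g, ‖P g‖ ^ 2 ≤ C) ∧
        (∀ g, ‖Q g‖ ^ 2 ≤ C) := by
  obtain ⟨K, i1, i2, i3, P, Q, h1, h2, h3⟩ :=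
    exists_factorization (fun h g => φ (h⁻¹ * g)) C (schur_of_cbBound hM hC)
  exact ⟨K, i1, i2, i3, P, Q, fun g h => h1 h g, fun g => (h2 g).le, fun g => (h3 g).le⟩

/-- A bounded family is weakly continuous as soon as its inner products with a total set are
continuous. -/
theorem continuous_inner_of_span {X K : Type*} [TopologicalSpace X] [NormedAddCommGroup K]
    [InnerProductSpace ℂ K] [CompleteSpace K] (s : Set K) (Q : X → K) (C : ℝ)
    (hQ : ∀ x, ‖Q x‖ ≤ C) (h : ∀ a ∈ s, Continuous fun x => inner ℂ a (Q x)) (a : K) :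
    Continuous fun x =>
      inner ℂ a ((Submodule.span ℂ s).topologicalClosure.starProjection (Q x)) := by
  set S := (Submodule.span ℂ s).topologicalClosure with hS
  have hclosed : ∀ y ∈ S, Continuous fun x => inner ℂ y (Q x) := by
    intro y hy
    rw [continuous_iff_continuousAt]
    intro x₀
    rw [Metric.continuousAt_iff']
    intro ε hε
    have hd : 0 < 3 * (|C| + 1) := by positivity
    obtain ⟨z, hz, hyz⟩ := Metric.mem_closure_iff.1 hy (ε / (3 * (|C| + 1))) (by positivity)
    have hzc : Continuous fun x => inner ℂ z (Q x) := by
      refine Submodule.span_induction (p := fun z _ => Continuous fun x => inner ℂ z (Q x))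
        (fun z hz => h z hz) (by simpa using continuous_const) (fun z w _ _ hz hw => ?_)
        (fun c z _ hz => ?_) hz
      · simp only [inner_add_left]
        exact hz.add hw
      · simp only [inner_smul_left]
        exact continuous_const.mul hz
    have hdiff : ∀ x, ‖inner ℂ y (Q x) - inner ℂ z (Q x)‖ ≤ ε / 3 := fun x => by
      rw [← inner_sub_left]
      refine (norm_inner_le_norm _ _).trans ?_
      rw [dist_eq_norm] at hyz
      calc ‖y - z‖ * ‖Q x‖ ≤ ε / (3 * (|C| + 1)) * (|C| + 1) := by
            gcongr
            have := hQ x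
            have := le_abs_self C
            linarith
        _ = ε / 3 := by field_simp
    filter_upwards [Metric.continuousAt_iff'.1 hzc.continuousAt (ε / 3) (by positivity)] with x hx
    rw [dist_eq_norm] at hx ⊢
    have e1 : inner ℂ y (Q x) - inner ℂ y (Q x₀) = (inner ℂ y (Q x) - inner ℂ z (Q x)) +
      (inner ℂ z (Q x) - inner ℂ z (Q x₀)) - (inner ℂ y (Q x₀) - inner ℂ z (Q x₀)) := by ring
    rw [e1]
    refine (norm_sub_le _ _).trans_lt ?_
    have := norm_add_le (inner ℂ y (Q x) - inner ℂ z (Q x)) (inner ℂ z (Q x) - inner ℂ z (Q x₀))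
    linarith [hdiff x, hdiff x₀]
  refine (hclosed (S.starProjection a) (Submodule.starProjection_apply_mem _ _)).congr fun x => ?_
  exact Submodule.inner_starProjection_left_eq_right S a (Q x)

/-- A completely bounded multiplier is given by a weakly continuous Hilbert space factorization
of the kernel `(h, g) ↦ φ (h⁻¹ g)`. -/
theorem exists_continuous_factorization {φ : G → ℂ} {M : LG G →ₗ[ℂ] LG G} {C : ℝ}
    (hM : IsMultiplierMap φ M) (hC : CBBound M C) :
    ∃ (K : Type u) (_ : NormedAddCommGroup K) (_ : InnerProductSpace ℂ K) (_ : CompleteSpace K)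
      (P Q : G → K), (∀ g h, inner ℂ (Q h) (P g) = φ (h⁻¹ * g)) ∧ (∀ g, ‖P g‖ ^ 2 ≤ C) ∧
        (∀ g, ‖Q g‖ ^ 2 ≤ C) ∧ (∀ a, Continuous fun g => inner ℂ a (P g)) ∧
        (∀ a, Continuous fun g => inner ℂ a (Q g)) := by
  obtain ⟨K, i1, i2, i3, P, Q, h1, h2, h3⟩ := exists_factorization_of_cbBound hM hC
  have hφ : Continuous φ := M0A.continuous_coe ⟨φ, M, hM, C, hC⟩
  have hle : ∀ (S : Submodule ℂ K) [S.HasOrthogonalProjection] (x : K), ‖x‖ ^ 2 ≤ C →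
      ‖S.starProjection x‖ ^ 2 ≤ C := fun S _ x hx =>
    (pow_le_pow_left₀ (norm_nonneg _) (S.norm_starProjection_apply_le x) 2).trans hx
  have hbd : ∀ x : K, ‖x‖ ^ 2 ≤ C → ‖x‖ ≤ √C := fun x hx => Real.le_sqrt_of_sq_le hx
  -- Projecting `Q` to the closed span of `P`, and then `P` to that of the new `Q'`, changes no
  -- inner product. Weak continuity then only has to be tested on a total set, where it is
  -- continuity of `φ`.
  set S := (Submodule.span ℂ (Set.range P)).topologicalClosure with hS
  let Q' : G → K := fun h => S.starProjection (Q h)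
  set T := (Submodule.span ℂ (Set.range Q')).topologicalClosure with hT
  have hQ' : ∀ a, Continuous fun g => inner ℂ a (Q' g) := by
    refine continuous_inner_of_span _ Q (√C) (fun x => hbd _ (h3 x)) ?_
    rintro _ ⟨g, rfl⟩
    have : Continuous fun h => conj (φ (h⁻¹ * g)) :=
      Complex.continuous_conj.comp (hφ.comp (by fun_prop))
    refine this.congr fun h => ?_
    rw [← h1, inner_conj_symm]
  have hPQ' : ∀ g h, inner ℂ (Q' h) (P g) = φ (h⁻¹ * g) := fun g h => by
    rw [← h1, Submodule.inner_starProjection_left_eq_right,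
      Submodule.starProjection_eq_self_iff.2]
    exact subset_closure (Submodule.subset_span ⟨g, rfl⟩)
  refine ⟨K, i1, i2, i3, fun g => T.starProjection (P g), Q', fun g h => ?_,
    fun g => hle _ _ (h2 g), fun g => hle _ _ (h3 g), ?_, hQ'⟩
  · rw [← hPQ', ← Submodule.inner_starProjection_left_eq_right,
      Submodule.starProjection_eq_self_iff.2]
    exact subset_closure (Submodule.subset_span ⟨h, rfl⟩)
  · refine continuous_inner_of_span _ P (√C) (fun x => hbd _ (h2 x)) ?_
    rintro _ ⟨h, rfl⟩
    have : Continuous fun g => φ (h⁻¹ * g) := hφ.comp (by fun_prop)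
    exact this.congr fun g => (hPQ' g h).symm

end Factorization

/-! ### Amplifications of operators to `ℓ²(J, H)` -/

section Amplification

variable {J N H : Type*} [NormedAddCommGroup H]

theorem memℓp_two_iff {f : J → H} : Memℓp f 2 ↔ Summable fun j => ‖f j‖ ^ 2 := by
  rw [memℓp_gen_iff (by norm_num)]
  simp

theorem lp_summable_norm_sq (x : lp (fun _ : J => H) 2) : Summable fun j => ‖x j‖ ^ 2 :=
  memℓp_two_iff.1 (lp.memℓp x)

theorem lp_hasSum_norm_sq (x : lp (fun _ : J => H) 2) :
    HasSum (fun j => ‖x j‖ ^ 2) (‖x‖ ^ 2) := by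
  have := lp.hasSum_norm (by norm_num) x
  simpa using this

theorem memℓp_flatten (A : lp (fun _ : N => lp (fun _ : J => H) 2) 2) :
    Memℓp (fun p : N × J => A p.1 p.2) 2 := by
  rw [memℓp_two_iff, summable_prod_of_nonneg fun _ => by positivity]
  refine ⟨fun n => lp_summable_norm_sq (A n), ?_⟩
  have h : ∀ n, ∑' j, ‖A n j‖ ^ 2 = ‖A n‖ ^ 2 := fun n => (lp_hasSum_norm_sq (A n)).tsum_eq
  simp only [h]
  exact lp_summable_norm_sq A

variable [InnerProductSpace ℂ H]

/-- The diagonal operator on `ℓ²(J, H)` with all entries equal to `T`. -/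
def amp (J : Type*) (T : H →L[ℂ] H) : lp (fun _ : J => H) 2 →L[ℂ] lp (fun _ : J => H) 2 :=
  LinearMap.mkContinuous
    { toFun := fun x => ⟨fun j => T (x j), memℓp_two_iff.2 <|
        Summable.of_nonneg_of_le (fun _ => by positivity)
          (fun j => by
            rw [← mul_pow]
            exact pow_le_pow_left₀ (norm_nonneg _) (T.le_opNorm (x j)) 2)
          ((lp_summable_norm_sq x).mul_left (‖T‖ ^ 2))⟩
      map_add' := fun x y => by ext j; exact map_add T (x j) (y j)
      map_smul' := fun c x => by ext j; exact map_smul T c (x j) } ‖T‖ fun x => by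
    refine le_of_sq_le_sq ?_ (by positivity)
    rw [mul_pow]
    refine hasSum_le (fun j => ?_) (lp_hasSum_norm_sq _) ((lp_hasSum_norm_sq x).mul_left _)
    rw [← mul_pow]
    exact pow_le_pow_left₀ (norm_nonneg _) (T.le_opNorm (x j)) 2

@[simp]
theorem amp_apply (T : H →L[ℂ] H) (x : lp (fun _ : J => H) 2) (j : J) : amp J T x j = T (x j) :=
  rfl

theorem amp_add (S T : H →L[ℂ] H) : amp J (S + T) = amp J S + amp J T := by
  ext x j; simp

theorem amp_smul (c : ℂ) (T : H →L[ℂ] H) : amp J (c • T) = c • amp J T := by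
  ext x j; simp

/-- Vector functionals of an amplification of arbitrary multiplicity are normal functionals. -/
theorem exists_normalFunctional_eq (α β : lp (fun _ : J => H) 2) :
    ∃ ξ η : lp (fun _ : ℕ => H) 2, ∀ T : H →L[ℂ] H,
      inner ℂ β (amp J T α) = normalFunctional ξ η T := by
  -- Only the countably many coordinates where `α` is nonzero contribute; these are reindexed by
  -- natural numbers, with zeros elsewhere.
  have hc : (Function.support fun j => ‖α j‖ ^ 2).Countable :=
    (lp_summable_norm_sq α).countable_support
  obtain ⟨f, hf⟩ := hc.exists_injective_nat
  have hmem : ∀ γ : lp (fun _ : J => H) 2, Memℓp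
      (Function.extend f (fun j => γ j.1) 0 : ℕ → H) 2 := fun γ => by
    rw [memℓp_two_iff]
    have h1 : (fun n => ‖(Function.extend f (fun j => γ j.1) 0 : ℕ → H) n‖ ^ 2) =
        Function.extend f (fun j => ‖γ j.1‖ ^ 2) 0 := by
      ext n
      rw [Function.apply_extend (fun x : H => ‖x‖ ^ 2)]
      congr 1
      ext; simp
    rw [h1]
    exact ((hasSum_extend_zero hf).2
      ((lp_summable_norm_sq γ).subtype _).hasSum).summable
  refine ⟨⟨_, hmem α⟩, ⟨_, hmem β⟩, fun T => ?_⟩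
  rw [lp.inner_eq_tsum, normalFunctional]
  have h2 : (fun n => inner ℂ ((Function.extend f (fun j => β j.1) 0 : ℕ → H) n)
      (T ((Function.extend f (fun j => α j.1) 0 : ℕ → H) n))) =
      Function.extend f (fun j => inner ℂ (β j.1) (T (α j.1))) 0 := by
    ext n
    by_cases hn : ∃ j, f j = n
    · obtain ⟨j, rfl⟩ := hn
      simp only [hf.extend_apply]
    · simp [Function.extend_apply' _ _ _ hn]
  change _ = ∑' n, inner ℂ ((Function.extend f (fun j => β j.1) 0 : ℕ → H) n)
      (T ((Function.extend f (fun j => α j.1) 0 : ℕ → H) n))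
  rw [h2, tsum_extend_zero hf]
  refine (tsum_subtype_eq_of_support_subset fun j hj => ?_).symm
  simp only [Function.mem_support, ne_eq, amp_apply] at hj ⊢
  contrapose! hj
  rw [norm_eq_zero.1 (pow_eq_zero_iff (two_ne_zero)|>.1 hj), map_zero, inner_zero_right]

/-- The canonical map `ℓ²(N, ℓ²(J, H)) → ℓ²(N × J, H)`. -/
def flatten (A : lp (fun _ : N => lp (fun _ : J => H) 2) 2) : lp (fun _ : N × J => H) 2 :=
  ⟨fun p => A p.1 p.2, memℓp_flatten A⟩

/-- Sums of vector functionals thus become a single vector functional of a larger amplification. -/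
theorem inner_flatten (A B : lp (fun _ : N => lp (fun _ : J => H) 2) 2) (T : H →L[ℂ] H) :
    inner ℂ (flatten B) (amp (N × J) T (flatten A)) = ∑' n, inner ℂ (B n) (amp J T (A n)) := by
  have h1 : Summable fun p : N × J => inner ℂ (B p.1 p.2) (T (A p.1 p.2)) :=
    lp.summable_inner (flatten B) (amp (N × J) T (flatten A))
  rw [lp.inner_eq_tsum]
  refine (h1.tsum_prod' fun n => lp.summable_inner (B n) (amp J T (A n))).trans ?_
  exact tsum_congr fun n => (lp.inner_eq_tsum (B n) (amp J T (A n))).symm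

end Amplification

/-! ### The double commutant argument: from `λ(G)` to `L(G)` -/

section Density

variable {G : Type*} [Group G] [TopologicalSpace G] [IsTopologicalGroup G]
  [LocallyCompactSpace G] [MeasurableSpace G] [BorelSpace G]

theorem star_leftRegular (g : G) : star (leftRegular g) = leftRegular g⁻¹ := by
  rw [ContinuousLinearMap.star_eq_adjoint, eq_comm, ContinuousLinearMap.eq_adjoint_iff]
  intro x y
  exact (inner_leftRegular g y x).symm

theorem mem_commutant_iff (X : L2 G →L[ℂ] L2 G) :
    X ∈ StarSubalgebra.centralizer ℂ (Set.range (leftRegular (G := G))) ↔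
      ∀ g, leftRegular g * X = X * leftRegular g := by
  rw [StarSubalgebra.mem_centralizer_iff]
  constructor
  · exact fun h g => (h _ ⟨g, rfl⟩).1
  · rintro h _ ⟨g, rfl⟩
    rw [star_leftRegular]
    exact ⟨h g, h g⁻¹⟩

theorem mem_LG_iff (T : L2 G →L[ℂ] L2 G) :
    T ∈ LG G ↔ ∀ X : L2 G →L[ℂ] L2 G, (∀ g, leftRegular g * X = X * leftRegular g) →
      X * T = T * X := by
  change T ∈ StarSubalgebra.centralizer ℂ
      (StarSubalgebra.centralizer ℂ (Set.range (leftRegular (G := G))) :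
        Set (L2 G →L[ℂ] L2 G)) ↔ _
  rw [StarSubalgebra.mem_centralizer_iff]
  constructor
  · exact fun h X hX => (h X ((mem_commutant_iff X).2 hX)).1
  · intro h X hX
    exact ⟨h X ((mem_commutant_iff X).1 hX), h _ ((mem_commutant_iff _).1 (star_mem hX))⟩

theorem inner_amp_leftRegular {J : Type*} (g : G) (x y : lp (fun _ : J => L2 G) 2) :
    inner ℂ y (amp J (leftRegular g) x) = inner ℂ (amp J (leftRegular g⁻¹) y) x := by
  rw [lp.inner_eq_tsum, lp.inner_eq_tsum]
  exact tsum_congr fun j => inner_leftRegular g (x j) (y j)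

/-- A vector functional of an amplification that vanishes on `λ(G)` vanishes on `L(G)`. -/
theorem inner_amp_eq_zero {J : Type*} (α β : lp (fun _ : J => L2 G) 2)
    (h : ∀ g : G, inner ℂ β (amp J (leftRegular g) α) = 0) {T : L2 G →L[ℂ] L2 G} (hT : T ∈ LG G) :
    inner ℂ β (amp J T α) = 0 := by
  classical
  -- `Z` is the cyclic subspace generated by `α`, and `β` is orthogonal to it. It remains to show
  -- that `T ⊗ 1` maps `α` into `Z`.
  set Z := (Submodule.span ℂ (Set.range fun g : G => amp J (leftRegular g) α)).topologicalClosure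
    with hZ
  have hβ : ∀ z ∈ Z, inner ℂ β z = 0 := by
    intro z hz
    refine closure_minimal (t := {z | inner ℂ β z = 0}) (fun z hz => ?_)
      (isClosed_eq (by fun_prop) continuous_const) hz
    refine Submodule.span_induction (p := fun z _ => inner ℂ β z = 0) ?_ (by simp)
      (fun x y _ _ hx hy => by rw [inner_add_right, hx, hy, add_zero])
      (fun c x _ hx => by rw [inner_smul_right, hx, mul_zero]) hz
    rintro _ ⟨g, rfl⟩
    exact h g
  have hmul : ∀ g k : G, amp J (leftRegular g) (amp J (leftRegular k) α) =
      amp J (leftRegular (g * k)) α := fun g k => by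
    ext1; ext1 j
    simp [leftRegular_mul]
  have hinv : ∀ g : G, ∀ z ∈ Z, amp J (leftRegular g) z ∈ Z := by
    intro g z hz
    refine map_mem_closure (amp J (leftRegular g)).continuous hz fun x hx => ?_
    refine Submodule.span_induction (p := fun z _ => amp J (leftRegular g) z ∈
      Submodule.span ℂ (Set.range fun g : G => amp J (leftRegular g) α)) ?_ (by simp)
      (fun x y _ _ hx hy => by rw [map_add]; exact Submodule.add_mem _ hx hy)
      (fun c x _ hx => by rw [map_smul]; exact Submodule.smul_mem _ _ hx) hx
    rintro _ ⟨k, rfl⟩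
    rw [hmul]
    exact Submodule.subset_span ⟨g * k, rfl⟩
  have hcomm : ∀ (g : G) (x : lp (fun _ : J => L2 G) 2),
      Z.starProjection (amp J (leftRegular g) x) = amp J (leftRegular g) (Z.starProjection x) := by
    intro g x
    refine Submodule.eq_starProjection_of_mem_of_inner_eq_zero
      (hinv g _ (Submodule.starProjection_apply_mem _ _)) fun z hz => ?_
    rw [← map_sub, ← inner_conj_symm, inner_amp_leftRegular, ← inner_conj_symm, Complex.conj_conj]
    exact Submodule.starProjection_inner_eq_zero x _ (hinv _ z hz)
  -- The matrix entries of the projection onto `Z`. They lie in the commutant of `λ(G)`, so they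
  -- commute with `T`, and hence the projection commutes with `T ⊗ 1`.
  let p : J → J → (L2 G →L[ℂ] L2 G) := fun m n =>
    lp.evalCLM ℂ (fun _ : J => L2 G) 2 m ∘L Z.starProjection ∘L
      lp.singleContinuousLinearMap ℂ (fun _ : J => L2 G) 2 n
  have hp : ∀ m n g, leftRegular g * p m n = p m n * leftRegular g := by
    intro m n g
    ext1 v
    have h1 : lp.single (E := fun _ : J => L2 G) 2 n (leftRegular g v) =
        amp J (leftRegular g) (lp.single 2 n v) := by
      ext1; ext1 j
      by_cases hj : j = n
      · subst hj; simp
      · simp [lp.single_apply, hj]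
    change leftRegular g (Z.starProjection (lp.single 2 n v) m) =
      Z.starProjection (lp.single 2 n (leftRegular g v)) m
    rw [h1, hcomm, amp_apply]
  have hTp : ∀ m n v, T (p m n v) = p m n (T v) := fun m n v =>
    (congrArg (fun S : L2 G →L[ℂ] L2 G => S v) ((mem_LG_iff T).1 hT (p m n) (hp m n))).symm
  have hsum : ∀ (x : lp (fun _ : J => L2 G) 2) m,
      HasSum (fun n => p m n (x n)) (Z.starProjection x m) := fun x m =>
    (lp.hasSum_single (by norm_num) x).mapL
      (lp.evalCLM ℂ (fun _ : J => L2 G) 2 m ∘L Z.starProjection)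
  have hcommT : ∀ x, amp J T (Z.starProjection x) = Z.starProjection (amp J T x) := by
    intro x
    ext1; ext1 m
    refine ((hsum x m).mapL T).unique ?_
    simp only [hTp]
    exact hsum (amp J T x) m
  have hα : α ∈ Z := by
    refine subset_closure (Submodule.subset_span ⟨1, ?_⟩)
    ext1; ext1 j
    simp [leftRegular_one]
  refine hβ _ ?_
  rw [← Submodule.starProjection_eq_self_iff.2 hα, hcommT]
  exact Submodule.starProjection_apply_mem _ _

end Density

/-! ### Column operators `L²(G) → L²(G, K)` of weakly continuous families -/

section Column

variable {G : Type*} [Group G] [TopologicalSpace G] [IsTopologicalGroup G]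
  [LocallyCompactSpace G] [MeasurableSpace G] [BorelSpace G]
variable {K : Type*} [NormedAddCommGroup K] [InnerProductSpace ℂ K]

/-- `P` is weakly continuous, and `‖P‖² ≤ C`. -/
structure IsBoundedColumn (P : G → K) (C : ℝ) : Prop where
  norm_sq_le : ∀ g, ‖P g‖ ^ 2 ≤ C
  continuous_inner : ∀ a, Continuous fun g => inner ℂ a (P g)

theorem L2_norm_sq (f : L2 G) : ‖f‖ ^ 2 = ∫ g, ‖f g‖ ^ 2 ∂(Measure.haar : Measure G) := by
  apply Complex.ofReal_injective
  have h : inner ℂ f f = ((‖f‖ ^ 2 : ℝ) : ℂ) := by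
    rw [inner_self_eq_norm_sq_to_K]; simp
  rw [← h, L2.inner_def, ← integral_complex_ofReal]
  congr 1
  ext g
  rw [inner_self_eq_norm_sq_to_K]; simp

theorem L2_integrable_norm_sq (f : L2 G) :
    Integrable (fun g => ‖f g‖ ^ 2) (Measure.haar : Measure G) :=
  (memLp_two_iff_integrable_sq_norm (Lp.memLp f).1).1 (Lp.memLp f)

namespace IsBoundedColumn

variable {P Q : G → K} {C : ℝ}

theorem nonneg (hP : IsBoundedColumn P C) : 0 ≤ C := (sq_nonneg _).trans (hP.norm_sq_le 1)

theorem norm_le (hP : IsBoundedColumn P C) (g : G) : ‖P g‖ ≤ √C :=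
  Real.le_sqrt_of_sq_le (hP.norm_sq_le g)

theorem memLp (hP : IsBoundedColumn P C) (a : K) (ξ : L2 G) :
    MemLp (fun g => inner ℂ a (P g) * ξ g) 2 (Measure.haar : Measure G) := by
  refine (Lp.memLp ξ).of_le_mul (c := ‖a‖ * √C)
    ((hP.continuous_inner a).aestronglyMeasurable.mul (Lp.memLp ξ).1) (.of_forall fun g => ?_)
  rw [norm_mul]
  gcongr
  exact (norm_inner_le_norm _ _).trans (by gcongr; exact hP.norm_le g)

/-- Multiplication by the function `g ↦ ⟨a, P g⟩` on `L²(G)`. -/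
def coef (hP : IsBoundedColumn P C) (a : K) : L2 G →ₗ[ℂ] L2 G where
  toFun ξ := (hP.memLp a ξ).toLp
  map_add' ξ η := by
    rw [← MemLp.toLp_add, MemLp.toLp_eq_toLp_iff]
    filter_upwards [Lp.coeFn_add ξ η] with g hg
    rw [hg, Pi.add_apply, Pi.add_apply, mul_add]
  map_smul' c ξ := by
    rw [RingHom.id_apply, ← MemLp.toLp_const_smul, MemLp.toLp_eq_toLp_iff]
    filter_upwards [Lp.coeFn_smul c ξ] with g hg
    rw [hg, Pi.smul_apply, Pi.smul_apply, smul_eq_mul, smul_eq_mul, mul_left_comm]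

theorem coeFn_coef (hP : IsBoundedColumn P C) (a : K) (ξ : L2 G) :
    hP.coef a ξ =ᵐ[Measure.haar] fun g => inner ℂ a (P g) * ξ g := (hP.memLp a ξ).coeFn_toLp

variable {I : Type*} (b : HilbertBasis I ℂ K)

theorem sum_norm_coef_le (hP : IsBoundedColumn P C) (ξ : L2 G) (F : Finset I) :
    ∑ i ∈ F, ‖hP.coef (b i) ξ‖ ^ 2 ≤ C * ‖ξ‖ ^ 2 := by
  simp only [L2_norm_sq]
  rw [← integral_finsetSum _ fun i _ => L2_integrable_norm_sq _, ← integral_const_mul]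
  refine integral_mono_ae (integrable_finsetSum _ fun i _ => L2_integrable_norm_sq _)
    ((L2_integrable_norm_sq ξ).const_mul C) ?_
  have h : ∀ᵐ g ∂(Measure.haar : Measure G), ∀ i ∈ F,
      hP.coef (b i) ξ g = inner ℂ (b i) (P g) * ξ g :=
    (Filter.eventually_all_finset F).2 fun i _ => hP.coeFn_coef (b i) ξ
  filter_upwards [h] with g hg
  calc ∑ i ∈ F, ‖hP.coef (b i) ξ g‖ ^ 2 = ∑ i ∈ F, ‖inner ℂ (b i) (P g)‖ ^ 2 * ‖ξ g‖ ^ 2 :=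
        Finset.sum_congr rfl fun i hi => by rw [hg i hi, norm_mul, mul_pow]
    _ ≤ C * ‖ξ g‖ ^ 2 := by
        rw [← Finset.sum_mul]
        gcongr
        exact (b.orthonormal.sum_inner_products_le (P g)).trans (hP.norm_sq_le g)

theorem summable_norm_coef (hP : IsBoundedColumn P C) (ξ : L2 G) :
    Summable fun i => ‖hP.coef (b i) ξ‖ ^ 2 :=
  summable_of_sum_le (fun _ => by positivity) (hP.sum_norm_coef_le b ξ)

/-- The column operator `ξ ↦ (⟨bᵢ, P⟩ ξ)ᵢ`, that is `ξ ↦ P ξ` for `L²(G, K) = ℓ²(I, L²(G))`. -/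
def col (hP : IsBoundedColumn P C) : L2 G →L[ℂ] lp (fun _ : I => L2 G) 2 :=
  LinearMap.mkContinuous
    { toFun := fun ξ => ⟨fun i => hP.coef (b i) ξ, memℓp_two_iff.2 (hP.summable_norm_coef b ξ)⟩
      map_add' := fun ξ η => by ext1; ext1 i; exact map_add _ ξ η
      map_smul' := fun c ξ => by ext1; ext1 i; exact map_smul _ c ξ } (√C) fun ξ => by
    refine le_of_sq_le_sq ?_ (by positivity)
    rw [mul_pow, Real.sq_sqrt hP.nonneg, ← (lp_hasSum_norm_sq _).tsum_eq]
    exact (hP.summable_norm_coef b ξ).tsum_le_of_sum_le (hP.sum_norm_coef_le b ξ)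

theorem col_apply (hP : IsBoundedColumn P C) (ξ : L2 G) (i : I) :
    hP.col b ξ i = hP.coef (b i) ξ := rfl

theorem norm_col_le (hP : IsBoundedColumn P C) : ‖hP.col b‖ ≤ √C :=
  LinearMap.mkContinuous_norm_le _ (Real.sqrt_nonneg _) _

/-- Formally this is Parseval under the integral sign. As `K` may be nonseparable, uncountably many
null sets could interfere; over an open set `U ⊇ s` of finite measure only countably many basis
vectors matter. -/
theorem inner_col_of_isOpen [CompleteSpace K] (hP : IsBoundedColumn P C) (hQ : IsBoundedColumn Q C)
    (c : ℂ) (hc : ∀ g, inner ℂ (Q g) (P g) = c) (w : L2 G) {s : Set G} (hs : MeasurableSet s)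
    (hμs : (Measure.haar : Measure G) s ≠ ⊤) :
    inner ℂ (hQ.col b w) (hP.col b (indicatorConstLp 2 hs hμs (1 : ℂ))) =
      c * inner ℂ w (indicatorConstLp 2 hs hμs (1 : ℂ)) := by
  classical
  obtain ⟨U, hsU, hU, hμU⟩ := s.exists_isOpen_lt_of_lt ⊤ hμs.lt_top
  set v : L2 G := indicatorConstLp 2 hs hμs (1 : ℂ) with hv
  let e : L2 G := indicatorConstLp 2 hU.measurableSet hμU.ne (1 : ℂ)
  let I₀ : Set I := Function.support fun i => ‖hP.coef (b i) e‖ ^ 2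
  have hI₀ : I₀.Countable := (hP.summable_norm_coef b e).countable_support
  have : Countable I₀ := hI₀
  -- Vanishing almost everywhere on the open set `U` is upgraded to vanishing everywhere by
  -- continuity.
  have hzero : ∀ i ∉ I₀, ∀ g ∈ U, inner ℂ (b i) (P g) = 0 := by
    intro i hi
    have h1 : hP.coef (b i) e = 0 := by simpa [I₀] using hi
    refine Measure.eqOn_open_of_ae_eq (μ := (Measure.haar : Measure G)) (g := fun _ => (0 : ℂ)) ?_
      hU (hP.continuous_inner _).continuousOn continuousOn_const
    rw [Filter.EventuallyEq, ae_restrict_iff' hU.measurableSet]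
    have h2 := hP.coeFn_coef (b i) e
    rw [h1] at h2
    filter_upwards [h2, Lp.coeFn_zero ℂ 2 (Measure.haar : Measure G),
      indicatorConstLp_coeFn (p := 2) (hs := hU.measurableSet) (hμs := hμU.ne) (c := (1 : ℂ))]
      with g h3 h4 h5 hgU
    rw [h4, h5, Set.indicator_of_mem hgU, mul_one] at h3
    exact h3.symm
  have hvs : ∀ᵐ g ∂(Measure.haar : Measure G), g ∉ U → v g = 0 := by
    filter_upwards [indicatorConstLp_coeFn (p := 2) (hs := hs) (hμs := hμs) (c := (1 : ℂ))]
      with g hg hgU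
    rw [hg, Set.indicator_of_notMem fun h => hgU (hsU h)]
  have hsupp : ∀ i ∉ I₀, hP.coef (b i) v = 0 := by
    intro i hi
    rw [Lp.eq_zero_iff_ae_eq_zero]
    filter_upwards [hP.coeFn_coef (b i) v, hvs] with g h1 h2
    rw [h1]
    by_cases hgU : g ∈ U
    · rw [hzero i hi g hgU, zero_mul]; rfl
    · rw [h2 hgU, mul_zero]; rfl
  have h1 : HasSum (fun i : I₀ => inner ℂ (hQ.coef (b i) w) (hP.coef (b i) v))
      (inner ℂ (hQ.col b w) (hP.col b v)) := by
    refine (hasSum_subtype_iff_of_support_subset fun i hi => ?_).2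
      (lp.hasSum_inner (hQ.col b w) (hP.col b v))
    by_contra hi'
    exact hi (by simp only [col_apply, hsupp i hi', inner_zero_right])
  refine h1.unique ?_
  simp only [L2.inner_def]
  have h2 := hasSum_integral_of_summable_integral_norm
    (F := fun (i : I₀) g => inner ℂ (hQ.coef (b i) w g) (hP.coef (b i) v g))
    (μ := (Measure.haar : Measure G)) (fun i => L2.integrable_inner _ _) ?_
  · suffices h3 : ∫ g, ∑' i : I₀, inner ℂ (hQ.coef (b i) w g) (hP.coef (b i) v g)
        ∂(Measure.haar : Measure G) = c * ∫ g, inner ℂ (w g) (v g) ∂(Measure.haar : Measure G) by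
      rw [← h3]
      exact h2
    rw [← integral_const_mul]
    refine integral_congr_ae ?_
    have h3 : ∀ᵐ g ∂(Measure.haar : Measure G), ∀ i : I₀,
        hP.coef (b i) v g = inner ℂ (b i) (P g) * v g :=
      ae_all_iff.2 fun i => hP.coeFn_coef (b i) v
    have h4 : ∀ᵐ g ∂(Measure.haar : Measure G), ∀ i : I₀,
        hQ.coef (b i) w g = inner ℂ (b i) (Q g) * w g :=
      ae_all_iff.2 fun i => hQ.coeFn_coef (b i) w
    filter_upwards [h3, h4, hvs] with g h5 h6 h7
    by_cases hgU : g ∈ U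
    · have h8 : HasSum (fun i : I₀ => inner ℂ (Q g) (b i) * inner ℂ (b i) (P g)) c := by
        rw [← hc g]
        refine (hasSum_subtype_iff_of_support_subset fun i hi => ?_).2
          (b.hasSum_inner_mul_inner (Q g) (P g))
        by_contra hi'
        exact hi (by simp only [hzero i hi' g hgU, mul_zero])
      rw [← (h8.mul_right (inner ℂ (w g) (v g))).tsum_eq]
      refine tsum_congr fun i => ?_
      rw [h5, h6]
      simp only [RCLike.inner_apply, map_mul, inner_conj_symm]
      ring
    · simp only [h5, h7 hgU, mul_zero, inner_zero_right, tsum_zero]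
  · refine Summable.of_nonneg_of_le (fun i => integral_nonneg fun g => norm_nonneg _) (fun i => ?_)
      (((hQ.summable_norm_coef b w).subtype I₀).add ((hP.summable_norm_coef b v).subtype I₀))
    change _ ≤ ‖hQ.coef (b i) w‖ ^ 2 + ‖hP.coef (b i) v‖ ^ 2
    rw [L2_norm_sq, L2_norm_sq, ← integral_add (L2_integrable_norm_sq _) (L2_integrable_norm_sq _)]
    refine integral_mono (L2.integrable_inner _ _).norm
      ((L2_integrable_norm_sq _).add (L2_integrable_norm_sq _)) fun g => ?_
    refine (norm_inner_le_norm _ _).trans ?_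
    change _ ≤ ‖hQ.coef (b i) w g‖ ^ 2 + ‖hP.coef (b i) v g‖ ^ 2
    nlinarith [sq_nonneg (‖hQ.coef (b i) w g‖ - ‖hP.coef (b i) v g‖),
      sq_nonneg (‖hQ.coef (b i) w g‖), sq_nonneg (‖hP.coef (b i) v g‖)]

/-- Both sides are linear and continuous in `v`, so indicators of sets of finite measure suffice. -/
theorem inner_col [CompleteSpace K] (hP : IsBoundedColumn P C) (hQ : IsBoundedColumn Q C)
    (c : ℂ) (hc : ∀ g, inner ℂ (Q g) (P g) = c) (w v : L2 G) :
    inner ℂ (hQ.col b w) (hP.col b v) = c * inner ℂ w v := by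
  induction v using Lp.induction (p := 2) (by norm_num) with
  | @indicatorConst a s hs hμs =>
    have h : ((Lp.simpleFunc.indicatorConst 2 hs hμs.ne a : Lp.simpleFunc ℂ 2 _) : L2 G) =
        a • indicatorConstLp 2 hs hμs.ne (1 : ℂ) := by
      rw [Lp.simpleFunc.coe_indicatorConst]
      apply Lp.ext
      filter_upwards [indicatorConstLp_coeFn (p := 2) (hs := hs) (hμs := hμs.ne) (c := a),
        indicatorConstLp_coeFn (p := 2) (hs := hs) (hμs := hμs.ne) (c := (1 : ℂ)),
        Lp.coeFn_smul a (indicatorConstLp 2 hs hμs.ne (1 : ℂ))] with g h1 h2 h3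
      rw [h1, h3, Pi.smul_apply, h2]
      by_cases hg : g ∈ s <;> simp [hg]
    rw [h, map_smul, inner_smul_right, inner_smul_right, inner_col_of_isOpen b hP hQ c hc,
      mul_left_comm]
  | add hf hg _ h1 h2 =>
    rw [map_add, inner_add_right, inner_add_right, h1, h2, mul_add]
  | isClosed => exact isClosed_eq (by fun_prop) (by fun_prop)

/-- The column of left translates. -/
theorem translate (hP : IsBoundedColumn P C) (s : G) :
    IsBoundedColumn (fun g => P (s⁻¹ * g)) C where
  norm_sq_le g := hP.norm_sq_le _
  continuous_inner a := (hP.continuous_inner a).comp (by fun_prop)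

theorem coeFn_leftRegular (s : G) (ξ : L2 G) :
    leftRegular s ξ =ᵐ[Measure.haar] fun g => ξ (s⁻¹ * g) :=
  Lp.coeFn_compMeasurePreserving ξ (measurePreserving_mul_left Measure.haar s⁻¹)

theorem amp_leftRegular_col (hP : IsBoundedColumn P C) (s : G) (ξ : L2 G) :
    amp I (leftRegular s) (hP.col b ξ) = (hP.translate s).col b (leftRegular s ξ) := by
  ext1; ext1 i
  rw [amp_apply, col_apply, col_apply]
  apply Lp.ext
  filter_upwards [coeFn_leftRegular s (hP.coef (b i) ξ), coeFn_leftRegular s ξ,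
    (hP.translate s).coeFn_coef (b i) (leftRegular s ξ),
    (measurePreserving_mul_left Measure.haar s⁻¹).quasiMeasurePreserving.ae (hP.coeFn_coef (b i) ξ)]
    with g h1 h2 h3 h4
  rw [h1, h3, h2, h4]

end IsBoundedColumn
end Column

/-! ### From factorizations to multiplier maps -/

section Multiplier

variable {G : Type*} [Group G] [TopologicalSpace G] [IsTopologicalGroup G]
  [LocallyCompactSpace G] [MeasurableSpace G] [BorelSpace G]
variable {K : Type*} [NormedAddCommGroup K] [InnerProductSpace ℂ K] [CompleteSpace K]

/-- Inner products `∑ₙ ⟨B n, (T ⊗ 1) (A n)⟩`, for finitely many `n`, that vanish on `λ(G)` vanish on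
`L(G)`. -/
theorem sum_inner_amp_eq_zero {I : Type*} {n : ℕ} (A B : Fin n → lp (fun _ : I => L2 G) 2)
    (h : ∀ g : G, ∑ k, inner ℂ (B k) (amp I (leftRegular g) (A k)) = 0) {T : L2 G →L[ℂ] L2 G}
    (hT : T ∈ LG G) : ∑ k, inner ℂ (B k) (amp I T (A k)) = 0 := by
  have hmem : ∀ D : Fin n → lp (fun _ : I => L2 G) 2, Memℓp D 2 := fun D =>
    memℓp_two_iff.2 (hasSum_fintype _).summable
  have key : ∀ S : L2 G →L[ℂ] L2 G,
      inner ℂ (flatten ⟨B, hmem B⟩) (amp (Fin n × I) S (flatten ⟨A, hmem A⟩)) =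
        ∑ k, inner ℂ (B k) (amp I S (A k)) := fun S => by
    rw [inner_flatten, tsum_fintype]
  rw [← key]
  exact inner_amp_eq_zero _ _ (fun g => by rw [key, h]) hT

namespace IsBoundedColumn

variable {P Q : G → K} {C : ℝ} {I : Type*} (b : HilbertBasis I ℂ K)

/-- The map `T ↦ Q* (T ⊗ 1) P` on the bounded operators of `L²(G)`. -/
def opMap (hP : IsBoundedColumn P C) (hQ : IsBoundedColumn Q C) :
    (L2 G →L[ℂ] L2 G) →ₗ[ℂ] (L2 G →L[ℂ] L2 G) where
  toFun T := (hQ.col b).adjoint ∘L amp I T ∘L hP.col b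
  map_add' S T := by
    rw [amp_add, ContinuousLinearMap.add_comp, ContinuousLinearMap.comp_add]
  map_smul' c T := by
    rw [amp_smul, ContinuousLinearMap.smul_comp, ContinuousLinearMap.comp_smul, RingHom.id_apply]

theorem inner_opMap (hP : IsBoundedColumn P C) (hQ : IsBoundedColumn Q C) (T : L2 G →L[ℂ] L2 G)
    (w v : L2 G) : inner ℂ w (opMap b hP hQ T v) = inner ℂ (hQ.col b w) (amp I T (hP.col b v)) :=
  (hQ.col b).adjoint_inner_right w (amp I T (hP.col b v))

/-- Moving `λ(s) ⊗ 1` past `P` translates `P`, and `Q*` times the translated column is the scalar `ψ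
s`. -/
theorem opMap_leftRegular (hP : IsBoundedColumn P C) (hQ : IsBoundedColumn Q C) {ψ : G → ℂ}
    (h : ∀ s t, inner ℂ (Q t) (P (s⁻¹ * t)) = ψ s) (s : G) :
    opMap b hP hQ (leftRegular s) = ψ s • leftRegular s := by
  ext1 v
  refine ext_inner_left ℂ fun w => ?_
  rw [inner_opMap, amp_leftRegular_col, inner_col b (hP.translate s) hQ (ψ s) (h s)]
  exact (inner_smul_right _ _ _).symm

/-- For `X` in the commutant, a matrix coefficient of the commutator of `X` with the image of `T` is
a sum of two vector functionals of `T ⊗ 1`. It vanishes for `T = λ(g)`, hence on all of `L(G)`. -/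
theorem opMap_mem (hP : IsBoundedColumn P C) (hQ : IsBoundedColumn Q C) {ψ : G → ℂ}
    (h : ∀ s t, inner ℂ (Q t) (P (s⁻¹ * t)) = ψ s) {T : L2 G →L[ℂ] L2 G} (hT : T ∈ LG G) :
    opMap b hP hQ T ∈ LG G := by
  rw [mem_LG_iff]
  intro X hX
  ext1 v
  refine ext_inner_left ℂ fun w => ?_
  have key : ∀ S : L2 G →L[ℂ] L2 G,
      ∑ k, inner ℂ (![hQ.col b (X.adjoint w), hQ.col b (-w)] k)
        (amp I S (![hP.col b v, hP.col b (X v)] k)) =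
      inner ℂ w (X (opMap b hP hQ S v)) - inner ℂ w (opMap b hP hQ S (X v)) := fun S => by
    simp only [Fin.sum_univ_two, Matrix.cons_val_zero, Matrix.cons_val_one, ← inner_opMap,
      inner_neg_left, ContinuousLinearMap.adjoint_inner_left, sub_eq_add_neg]
  have h0 := sum_inner_amp_eq_zero ![hP.col b v, hP.col b (X v)]
    ![hQ.col b (X.adjoint w), hQ.col b (-w)] (fun g => by
      rw [key, opMap_leftRegular b hP hQ h]
      have := congrArg (fun S : L2 G →L[ℂ] L2 G => S v) (hX g)
      change leftRegular g (X v) = X (leftRegular g v) at this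
      change inner ℂ w (X (ψ g • leftRegular g v)) - inner ℂ w (ψ g • leftRegular g (X v)) = 0
      rw [map_smul, this, sub_self]) hT
  rw [key] at h0
  exact sub_eq_zero.1 h0

/-- The columns have norm at most `√C` each, and amplifying `x` over the basis index does not
increase its norm: `x` acts on each slice `V i` separately. -/
theorem norm_opMatrix_opMap_le (hP : IsBoundedColumn P C) (hQ : IsBoundedColumn Q C) {n : ℕ}
    (x : Fin n → Fin n → (L2 G →L[ℂ] L2 G)) :
    ‖opMatrix fun i j => opMap b hP hQ (x i j)‖ ≤ C * ‖opMatrix x‖ := by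
  have hC := hP.nonneg
  refine ContinuousLinearMap.opNorm_le_bound _ (by positivity) fun v => ?_
  let y : Fin n → lp (fun _ : I => L2 G) 2 := fun k => ∑ l, amp I (x k l) (hP.col b (v l))
  have h1 : ∀ k, opMatrix (fun i j => opMap b hP hQ (x i j)) v k = (hQ.col b).adjoint (y k) :=
    fun k => by
      rw [opMatrix_apply, map_sum]
      rfl
  have hcol : ∀ {P : G → K} (hP : IsBoundedColumn P C) (u : L2 G),
      ‖hP.col b u‖ ^ 2 ≤ C * ‖u‖ ^ 2 := fun hP u => by
    have := (hP.col b).le_of_opNorm_le (hP.norm_col_le b) u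
    calc ‖hP.col b u‖ ^ 2 ≤ (√C * ‖u‖) ^ 2 := by gcongr
      _ = C * ‖u‖ ^ 2 := by rw [mul_pow, Real.sq_sqrt hC]
  have hadj : ∀ z, ‖(hQ.col b).adjoint z‖ ^ 2 ≤ C * ‖z‖ ^ 2 := fun z => by
    have := (hQ.col b).adjoint.le_of_opNorm_le
      ((LinearIsometryEquiv.norm_map _ _).trans_le (hQ.norm_col_le b)) z
    calc ‖(hQ.col b).adjoint z‖ ^ 2 ≤ (√C * ‖z‖) ^ 2 := by gcongr
      _ = C * ‖z‖ ^ 2 := by rw [mul_pow, Real.sq_sqrt hC]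
  let V : I → PiLp 2 (fun _ : Fin n => L2 G) := fun i => WithLp.toLp 2 fun l => hP.col b (v l) i
  have h2 : ∀ i k, y k i = opMatrix x (V i) k := fun i k => by
    rw [opMatrix_apply]
    simp only [y, lp.coeFn_sum, Finset.sum_apply, amp_apply, V]
  have h3 : HasSum (fun i => ‖opMatrix x (V i)‖ ^ 2) (∑ k, ‖y k‖ ^ 2) := by
    simp only [PiLp.norm_sq_eq_of_L2, ← h2]
    exact hasSum_sum fun k _ => lp_hasSum_norm_sq (y k)
  have h4 : HasSum (fun i => ‖V i‖ ^ 2) (∑ l, ‖hP.col b (v l)‖ ^ 2) := by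
    simp only [PiLp.norm_sq_eq_of_L2]
    exact hasSum_sum fun l _ => lp_hasSum_norm_sq (hP.col b (v l))
  have h5 : ∑ k, ‖y k‖ ^ 2 ≤ ‖opMatrix x‖ ^ 2 * ∑ l, ‖hP.col b (v l)‖ ^ 2 := by
    refine hasSum_le (fun i => ?_) h3 (h4.mul_left _)
    rw [← mul_pow]
    exact pow_le_pow_left₀ (norm_nonneg _) (ContinuousLinearMap.le_opNorm _ _) 2
  refine le_of_sq_le_sq ?_ (by positivity)
  calc ‖opMatrix (fun i j => opMap b hP hQ (x i j)) v‖ ^ 2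
      = ∑ k, ‖(hQ.col b).adjoint (y k)‖ ^ 2 := by
        rw [PiLp.norm_sq_eq_of_L2]
        simp only [h1]
    _ ≤ C * ∑ k, ‖y k‖ ^ 2 := by
        rw [Finset.mul_sum]
        exact Finset.sum_le_sum fun k _ => hadj (y k)
    _ ≤ C * (‖opMatrix x‖ ^ 2 * ∑ l, ‖hP.col b (v l)‖ ^ 2) := by gcongr
    _ ≤ C * (‖opMatrix x‖ ^ 2 * (C * ∑ l, ‖v l‖ ^ 2)) := by
        gcongr
        rw [Finset.mul_sum]
        exact Finset.sum_le_sum fun l _ => hcol hP (v l)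
    _ = (C * ‖opMatrix x‖ * ‖v‖) ^ 2 := by
        rw [← PiLp.norm_sq_eq_of_L2]
        ring

/-- This gives normality of the multiplier map. The vectors live on `ℕ × I` with `I` possibly
uncountable, and `exists_normalFunctional_eq` brings them back to `ℕ`. -/
theorem exists_normalFunctional_opMap (hP : IsBoundedColumn P C) (hQ : IsBoundedColumn Q C)
    (ξ η : lp (fun _ : ℕ => L2 G) 2) : ∃ ξ' η' : lp (fun _ : ℕ => L2 G) 2,
      ∀ T : L2 G →L[ℂ] L2 G, normalFunctional ξ η (opMap b hP hQ T) = normalFunctional ξ' η' T := by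
  have hmem : ∀ {P : G → K} (hP : IsBoundedColumn P C) (ζ : lp (fun _ : ℕ => L2 G) 2),
      Memℓp (fun n => hP.col b (ζ n)) 2 := fun hP ζ => by
    refine memℓp_two_iff.2 (Summable.of_nonneg_of_le (fun _ => by positivity) (fun n => ?_)
      ((lp_summable_norm_sq ζ).mul_left (‖hP.col b‖ ^ 2)))
    rw [← mul_pow]
    exact pow_le_pow_left₀ (norm_nonneg _) (ContinuousLinearMap.le_opNorm _ _) 2
  obtain ⟨ξ', η', h⟩ := exists_normalFunctional_eq (flatten ⟨_, hmem hP ξ⟩) (flatten ⟨_, hmem hQ η⟩)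
  refine ⟨ξ', η', fun T => ?_⟩
  rw [← h, inner_flatten]
  exact tsum_congr fun n => inner_opMap b hP hQ T _ _

/-- A factorization of the kernel `(t, s) ↦ ψ (t s⁻¹)` through a Hilbert space makes `ψ` a
completely bounded multiplier. -/
theorem exists_isMultiplierMap (hP : IsBoundedColumn P C) (hQ : IsBoundedColumn Q C) {ψ : G → ℂ}
    (h : ∀ s t, inner ℂ (Q t) (P (s⁻¹ * t)) = ψ s) :
    ∃ M : LG G →ₗ[ℂ] LG G, IsMultiplierMap ψ M ∧ CBBound M C := by
  obtain ⟨_, b, -⟩ := exists_hilbertBasis ℂ K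
  let M : LG G →ₗ[ℂ] LG G :=
    { toFun := fun T => ⟨opMap b hP hQ T, opMap_mem b hP hQ h T.2⟩
      map_add' := fun S T => Subtype.ext (map_add (opMap b hP hQ) (S : L2 G →L[ℂ] L2 G) T)
      map_smul' := fun c T => Subtype.ext (map_smul (opMap b hP hQ) c (T : L2 G →L[ℂ] L2 G)) }
  refine ⟨M, ⟨fun g => Subtype.ext (opMap_leftRegular b hP hQ h g), ?_⟩,
    fun n x => norm_opMatrix_opMap_le b hP hQ _⟩
  rw [isNormalMap_iff]
  intro ξ η
  obtain ⟨ξ', η', h'⟩ := exists_normalFunctional_opMap b hP hQ ξ η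
  let _ := ultraweakLG G
  let _ := ultraweakTopology (L2 G)
  refine ((continuous_normalFunctional ξ' η').comp
    (continuous_induced_dom (f := fun T : LG G => (T : L2 G →L[ℂ] L2 G)))).congr fun T => ?_
  exact (h' T).symm

end IsBoundedColumn

end Multiplier

/-! ### Pullback of multipliers along homomorphisms -/

section Pullback

variable {G : Type*} [Group G] [TopologicalSpace G] [IsTopologicalGroup G]
  [LocallyCompactSpace G] [MeasurableSpace G] [BorelSpace G]
  {H : Type*} [Group H] [TopologicalSpace H] [IsTopologicalGroup H]
  [LocallyCompactSpace H] [MeasurableSpace H] [BorelSpace H]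

theorem exists_isMultiplierMap_comp (π : G →* H) (hπ : Continuous π) (k : H) {φ : H → ℂ}
    {M : LG H →ₗ[ℂ] LG H} {C : ℝ} (hM : IsMultiplierMap φ M) (hC : CBBound M C) :
    ∃ M' : LG G →ₗ[ℂ] LG G, IsMultiplierMap (fun g => φ (π g * k)) M' ∧ CBBound M' C := by
  obtain ⟨K, _, _, _, P, Q, hPQ, hP, hQ, hPc, hQc⟩ := exists_continuous_factorization hM hC
  -- The inverses convert the kernel `φ (h⁻¹ g)` into the convention of `exists_isMultiplierMap`:
  -- `π(t) π(s⁻¹ t)⁻¹ k = π(s) k`.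
  have hP' : IsBoundedColumn (fun g => P ((π g)⁻¹ * k)) C :=
    ⟨fun g => hP _, fun a => (hPc a).comp (by fun_prop)⟩
  have hQ' : IsBoundedColumn (fun g => Q (π g)⁻¹) C :=
    ⟨fun g => hQ _, fun a => (hQc a).comp (by fun_prop)⟩
  refine hP'.exists_isMultiplierMap hQ' fun s t => ?_
  rw [hPQ]
  congr 1
  simp [mul_assoc]

namespace M0A

/-- The pullback `g ↦ φ (π g k)` of a completely bounded multiplier. -/
def pullback (π : G →* H) (hπ : Continuous π) (k : H) : M0A H →ₗ[ℂ] M0A G where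
  toFun φ := ⟨fun g => φ (π g * k), by
    obtain ⟨M, hM, C, hC⟩ := φ.2
    obtain ⟨M', hM', hC'⟩ := exists_isMultiplierMap_comp π hπ k hM hC
    exact ⟨M', hM', C, hC'⟩⟩
  map_add' φ ψ := rfl
  map_smul' c φ := rfl

theorem pullback_apply (π : G →* H) (hπ : Continuous π) (k : H) (φ : M0A H) (g : G) :
    pullback π hπ k φ g = φ (π g * k) := rfl

theorem norm_pullback_le (π : G →* H) (hπ : Continuous π) (k : H) (φ : M0A H) :
    ‖pullback π hπ k φ‖ ≤ ‖φ‖ := by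
  refine le_of_forall_gt_imp_ge_of_dense fun C hC => ?_
  obtain ⟨M, hM, hMC⟩ := exists_cbBound_of_norm_lt hC
  obtain ⟨M', hM', hC'⟩ := exists_isMultiplierMap_comp π hπ k hM hMC
  exact norm_le_of_cbBound ((norm_nonneg φ).trans hC.le) hM' hC'

end M0A
end Pullback

/-! ### Density of compactly supported continuous functions in `L¹` -/

section Approximation

open scoped ENNReal NNReal

/-- In a locally compact regular space, continuous functions with compact support are dense
in `L¹`. -/
theorem exists_hasCompactSupport_integral_norm_sub_le {α : Type*} [TopologicalSpace α]
    [RegularSpace α] [LocallyCompactSpace α] [MeasurableSpace α] [BorelSpace α] {μ : Measure α}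
    [μ.Regular] {f : α → ℂ} (hf : Integrable f μ) {ε : ℝ} (hε : 0 < ε) :
    ∃ g : α → ℂ, HasCompactSupport g ∧ (∫ x, ‖f x - g x‖ ∂μ) ≤ ε ∧ Continuous g ∧
      Integrable g μ := by
  have hf1 : MemLp f 1 μ := memLp_one_iff_integrable.2 hf
  obtain ⟨g, hg, hgc, hgs⟩ : ∃ g : α → ℂ, eLpNorm (f - g) 1 μ ≤ ENNReal.ofReal ε ∧
      (Continuous g ∧ HasCompactSupport g) := by
    refine hf1.induction_dense ENNReal.one_ne_top _ ?_ ?_ ?_ (by simpa using hε)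
    · intro c t ht htμ ε hε
      obtain ⟨δ, δpos, hδ⟩ := exists_Lp_half ℂ μ 1 hε
      obtain ⟨η, ηpos, hη⟩ := exists_eLpNorm_indicator_le (μ := μ) ENNReal.one_ne_top c δpos.ne'
      have hη0 : (0 : ℝ≥0∞) < η := ENNReal.coe_pos.2 ηpos
      obtain ⟨s, st, hsc, hs, μs⟩ := ht.exists_isCompact_isClosed_sdiff_lt htμ.ne hη0.ne'
      have hsμ : μ s < ∞ := (measure_mono st).trans_lt htμ
      obtain ⟨V, sV, hV, -, μV⟩ := hs.measurableSet.exists_isOpen_sdiff_lt hsμ.ne hη0.ne'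
      -- A Urysohn function between `s` and `V` differs from the indicator of `s` only on the small
      -- set `V \ s`.
      obtain ⟨k, hks, hkV, hkc, hk⟩ := exists_continuous_one_zero_of_isCompact hsc
        hV.isClosed_compl (Set.disjoint_compl_right_iff_subset.2 sV)
      have h1 : eLpNorm ((s.indicator fun _ => c) - t.indicator fun _ => c) 1 μ ≤ δ := by
        rw [← eLpNorm_neg, neg_sub, ← Set.indicator_sdiff st]
        exact hη _ μs.le
      have hkcont : Continuous fun x => k x • c := by fun_prop
      have h2 : eLpNorm ((fun x => k x • c) - s.indicator fun _ => c) 1 μ ≤ δ := by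
        refine (eLpNorm_mono fun x => ?_).trans (hη (V \ s) μV.le)
        by_cases hxs : x ∈ s
        · simp [hxs, hks hxs]
        by_cases hxV : x ∈ V
        · have : ‖k x‖ ≤ 1 := by
            rw [Real.norm_of_nonneg (hk x).1]
            exact (hk x).2
          simpa [hxs, hxV] using mul_le_of_le_one_left (norm_nonneg c) this
        · simp [hxs, hxV, hkV hxV]
      refine ⟨fun x => k x • c, ?_, hkcont, hkc.smul_right⟩
      have hms := (aestronglyMeasurable_const (μ := μ) (b := c)).indicator hs.measurableSet
      have hmt := (aestronglyMeasurable_const (μ := μ) (b := c)).indicator ht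
      have := hδ _ _ (hkcont.aestronglyMeasurable.sub hms) (hms.sub hmt) h2 h1
      rw [sub_add_sub_cancel] at this
      exact this.le
    · rintro f g ⟨hf, hfs⟩ ⟨hg, hgs⟩
      exact ⟨hf.add hg, hfs.add hgs⟩
    · rintro f ⟨hf, hfs⟩
      exact (hf.integrable_of_hasCompactSupport hfs).aestronglyMeasurable
  have hgi := hgc.integrable_of_hasCompactSupport (μ := μ) hgs
  refine ⟨g, hgs, ?_, hgc, hgi⟩
  rwa [eLpNorm_one_eq_lintegral_enorm, ← ofReal_integral_norm_eq_lintegral_enorm (hf.sub hgi),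
    ENNReal.ofReal_le_ofReal_iff hε.le] at hg

end Approximation

/-! ### Invariant means and their transfer to the image group -/

section Means

variable {G : Type*} [Group G] [TopologicalSpace G] [IsTopologicalGroup G]
  [LocallyCompactSpace G] [MeasurableSpace G] [BorelSpace G]

/-- A weak* continuous functional belongs to the predual. -/
theorem IsWeakStarContinuous.exists_mem_predual {m : M0A G →ₗ[ℂ] ℂ} (hm : IsWeakStarContinuous m) :
    ∃ x ∈ predual G, ∀ φ, m φ = x φ := by
  let m' : StrongDual ℂ (WeakBilin (predualPairing G)) :=
    { toFun := m, map_add' := map_add m, map_smul' := map_smul m, cont := hm }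
  obtain ⟨x, hx⟩ := @LinearMap.dualEmbedding_surjective ℂ (M0A G) (predual G) _ _ _ _ _
    (predualPairing G) m'
  exact ⟨x, x.2, fun φ => (DFunLike.congr_fun hx φ).symm⟩

theorem isWeakStarContinuous_of_mem_predual {m : M0A G →ₗ[ℂ] ℂ} {x : StrongDual ℂ (M0A G)}
    (hx : x ∈ predual G) (h : ∀ φ, m φ = x φ) : IsWeakStarContinuous m :=
  (WeakBilin.eval_continuous (predualPairing G) ⟨x, hx⟩).congr fun φ => (h φ).symm

theorem L1toDual_toL1_apply {f : G → ℂ} (hf : Integrable f (Measure.haar : Measure G))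
    (φ : M0A G) : L1toDual G (hf.toL1 f) φ = ∫ g, f g * φ g ∂(Measure.haar : Measure G) := by
  rw [L1toDual_apply]
  refine integral_congr_ae ?_
  filter_upwards [hf.coeFn_toL1] with g hg
  rw [hg]

/-- Elements of the predual are norm limits of compactly supported continuous functions. -/
theorem exists_hasCompactSupport_of_mem_predual {x : StrongDual ℂ (M0A G)} (hx : x ∈ predual G)
    {ε : ℝ} (hε : 0 < ε) : ∃ f : G → ℂ, Continuous f ∧ HasCompactSupport f ∧
      ∀ φ : M0A G, ‖x φ - ∫ g, f g * φ g ∂(Measure.haar : Measure G)‖ ≤ ε * ‖φ‖ := by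
  obtain ⟨_, ⟨f₀, rfl⟩, hf₀⟩ := Metric.mem_closure_iff.1 hx (ε / 2) (half_pos hε)
  obtain ⟨f, hfs, hfi, hfc, hf⟩ :=
    exists_hasCompactSupport_integral_norm_sub_le (L1.integrable_coeFn f₀) (half_pos hε)
  refine ⟨f, hfc, hfs, fun φ => ?_⟩
  have h1 : ‖x φ - L1toDual G f₀ φ‖ ≤ ε / 2 * ‖φ‖ := by
    rw [dist_eq_norm] at hf₀
    exact (x - L1toDual G f₀).le_of_opNorm_le hf₀.le φ
  have h2 : ‖L1toDual G f₀ φ - ∫ g, f g * φ g ∂(Measure.haar : Measure G)‖ ≤ ε / 2 * ‖φ‖ := by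
    have hi : Integrable (fun g => f g * φ g) (Measure.haar : Measure G) :=
      hf.mul_bdd (c := ‖φ‖) (M0A.continuous_coe φ).aestronglyMeasurable
        (.of_forall (M0A.norm_apply_le φ))
    rw [L1toDual_apply, ← integral_sub (M0A.integrable_mul f₀ φ) hi]
    refine (norm_integral_le_of_norm_le (((L1.integrable_coeFn f₀).sub hf).norm.mul_const ‖φ‖)
      (.of_forall fun g => ?_)).trans ?_
    · rw [← sub_mul, norm_mul]
      exact mul_le_mul_of_nonneg_left (M0A.norm_apply_le φ g) (norm_nonneg _)
    · rw [integral_mul_const]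
      exact mul_le_mul_of_nonneg_right hfi (norm_nonneg φ)
  calc ‖x φ - ∫ g, f g * φ g ∂(Measure.haar : Measure G)‖
      = ‖(x φ - L1toDual G f₀ φ) +
          (L1toDual G f₀ φ - ∫ g, f g * φ g ∂(Measure.haar : Measure G))‖ := by
        rw [sub_add_sub_cancel]
    _ ≤ ε / 2 * ‖φ‖ + ε / 2 * ‖φ‖ := (norm_add_le _ _).trans (add_le_add h1 h2)
    _ = ε * ‖φ‖ := by ring

theorem mem_predual_of_forall_approx {x : StrongDual ℂ (M0A G)}
    (h : ∀ ε > 0, ∃ f : G → ℂ, Integrable f (Measure.haar : Measure G) ∧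
      ∀ φ : M0A G, ‖x φ - ∫ g, f g * φ g ∂(Measure.haar : Measure G)‖ ≤ ε * ‖φ‖) :
    x ∈ predual G := by
  refine Metric.mem_closure_iff.2 fun ε hε => ?_
  obtain ⟨f, hf, hfx⟩ := h (ε / 2) (half_pos hε)
  refine ⟨L1toDual G (hf.toL1 f), ⟨_, rfl⟩, ?_⟩
  rw [dist_eq_norm]
  refine (ContinuousLinearMap.opNorm_le_bound _ (half_pos hε).le fun φ => ?_).trans_lt
    (half_lt_self hε)
  rw [sub_apply, L1toDual_toL1_apply]
  exact hfx φ

variable {H : Type u} [Group H] [TopologicalSpace H] [IsTopologicalGroup H]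
  [LocallyCompactSpace H] [MeasurableSpace H] [BorelSpace H]

/-- Right translation by `k` commutes with left translations, and surjectivity lifts each left
translation of `H` to one of `G`. -/
theorem IsLeftInvariantMean.pullback {m : M0A G →ₗ[ℂ] ℂ} (hm : IsLeftInvariantMean m)
    (π : G →* H) (hπ : Continuous π) (hsurj : Function.Surjective π) (k : H) :
    IsLeftInvariantMean (m ∘ₗ M0A.pullback π hπ k) where
  nonneg φ h := hm.nonneg _ fun g => h _
  norm_le φ C h := hm.norm_le _ C fun g => h _
  map_one := hm.map_one
  map_translate h φ := by
    obtain ⟨g, rfl⟩ := hsurj h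
    refine (congrArg m (M0A.ext fun x => ?_)).trans (hm.map_translate g _)
    simp only [M0A.pullback_apply, M0A.translate_apply, map_mul, map_inv, mul_assoc]

/-- A unique left invariant mean is right invariant. -/
theorem apply_pullback_eq {m : M0A G →ₗ[ℂ] ℂ} (hm : IsLeftInvariantMean m)
    (huniq : ∀ m', IsLeftInvariantMean m' → m' = m) (π : G →* H) (hπ : Continuous π)
    (hsurj : Function.Surjective π) (k : H) (φ : M0A H) :
    m (M0A.pullback π hπ k φ) = m (M0A.pullback π hπ 1 φ) := by
  obtain ⟨g, rfl⟩ := hsurj k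
  -- Right translating `m` by `g` gives another left invariant mean on `G`, hence `m` itself.
  have h := huniq _ (hm.pullback (MonoidHom.id G) continuous_id Function.surjective_id g)
  conv_rhs => rw [← h]
  rw [LinearMap.comp_apply]
  congr 1
  refine M0A.ext fun x => ?_
  simp only [M0A.pullback_apply, map_mul, mul_one, MonoidHom.id_apply]

theorem continuous_integral_mul_apply {f : G → ℂ} (hfc : Continuous f) (hfs : HasCompactSupport f)
    (π : G →* H) (hπ : Continuous π) {ψ : H → ℂ} (hψ : Continuous ψ) (ι : H → H → H)
    (hι : Continuous fun p : H × H => ι p.1 p.2) :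
    Continuous fun h => ∫ g, f g * ψ (ι (π g) h) ∂(Measure.haar : Measure G) := by
  rw [← continuousOn_univ]
  refine continuousOn_integral_of_compact_support hfs (Continuous.continuousOn ?_) ?_
  · exact (hfc.comp continuous_snd).mul
      (hψ.comp (hι.comp ((hπ.comp continuous_snd).prodMk continuous_fst)))
  · intro h g _ hg
    rw [image_eq_zero_of_notMem_tsupport hg, zero_mul]

theorem hasCompactSupport_smear {f : G → ℂ} (hfs : HasCompactSupport f) (π : G →* H)
    (hπ : Continuous π) {u : H → ℂ} (hus : HasCompactSupport u) :
    HasCompactSupport fun y => ∫ g, f g * u ((π g)⁻¹ * y) ∂(Measure.haar : Measure G) := by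
  refine HasCompactSupport.intro ((hfs.image hπ).mul hus) fun y hy => ?_
  refine integral_eq_zero_of_ae (.of_forall fun g => ?_)
  by_contra hne
  refine hy ⟨π g, ⟨g, subset_tsupport f (left_ne_zero_of_mul hne), rfl⟩, (π g)⁻¹ * y,
    subset_tsupport u (right_ne_zero_of_mul hne), ?_⟩
  exact mul_inv_cancel_left _ _

/-- The image in `H` of a function on `G`, smeared out by `u`, as a functional. -/
theorem integral_smear_mul {f : G → ℂ} (hfc : Continuous f) (hfs : HasCompactSupport f)
    (π : G →* H) (hπ : Continuous π) {u : H → ℂ} (huc : Continuous u) (hus : HasCompactSupport u)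
    (φ : M0A H) :
    ∫ y, (∫ g, f g * u ((π g)⁻¹ * y) ∂(Measure.haar : Measure G)) * φ y
        ∂(Measure.haar : Measure H) =
      ∫ h, u h * ∫ g, f g * φ (π g * h) ∂(Measure.haar : Measure G)
        ∂(Measure.haar : Measure H) := by
  have hφ := M0A.continuous_coe φ
  calc ∫ y, (∫ g, f g * u ((π g)⁻¹ * y) ∂(Measure.haar : Measure G)) * φ y
        ∂(Measure.haar : Measure H)
      = ∫ y, ∫ g, f g * u ((π g)⁻¹ * y) * φ y ∂(Measure.haar : Measure G)
        ∂(Measure.haar : Measure H) := by simp only [integral_mul_const]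
    _ = ∫ g, ∫ y, f g * u ((π g)⁻¹ * y) * φ y ∂(Measure.haar : Measure H)
        ∂(Measure.haar : Measure G) := by
        refine integral_integral_swap_of_hasCompactSupport ?_ ?_
        · simp only [Function.uncurry_def]
          fun_prop
        · refine HasCompactSupport.intro (((hfs.image hπ).mul hus).prod hfs) fun p hp => ?_
          by_contra hne
          have h1 := left_ne_zero_of_mul hne
          have hf' := subset_tsupport f (left_ne_zero_of_mul h1)
          refine hp ⟨⟨π p.2, ⟨p.2, hf', rfl⟩, (π p.2)⁻¹ * p.1,
            subset_tsupport u (right_ne_zero_of_mul h1), ?_⟩, hf'⟩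
          exact mul_inv_cancel_left _ _
    _ = ∫ g, ∫ h, f g * u h * φ (π g * h) ∂(Measure.haar : Measure H)
        ∂(Measure.haar : Measure G) := by
        congr 1
        ext g
        -- The substitution `y = π(g) h`, by left invariance of Haar measure on `H`.
        rw [← integral_mul_left_eq_self _ (π g)]
        simp only [inv_mul_cancel_left]
    _ = ∫ h, ∫ g, f g * u h * φ (π g * h) ∂(Measure.haar : Measure G)
        ∂(Measure.haar : Measure H) := by
        refine integral_integral_swap_of_hasCompactSupport ?_ ?_
        · simp only [Function.uncurry_def]
          fun_prop
        · refine HasCompactSupport.intro (hfs.prod hus) fun p hp => ?_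
          by_contra hne
          have h1 := left_ne_zero_of_mul hne
          exact hp ⟨subset_tsupport f (left_ne_zero_of_mul h1),
            subset_tsupport u (right_ne_zero_of_mul h1)⟩
    _ = _ := by
        congr 1
        ext h
        rw [← integral_const_mul]
        congr 1
        ext g
        ring

variable (H) in
theorem exists_integral_eq_one : ∃ u : H → ℝ, Continuous u ∧ HasCompactSupport u ∧ (∀ h, 0 ≤ u h) ∧
    ∫ h, u h ∂(Measure.haar : Measure H) = 1 := by
  obtain ⟨u, hus, hu0, hu1⟩ := exists_continuous_nonneg_pos (1 : H)
  have hpos : 0 < ∫ h, u h ∂(Measure.haar : Measure H) :=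
    u.continuous.integral_pos_of_hasCompactSupport_nonneg_nonzero hus hu0 hu1
  refine ⟨fun h => (∫ h, u h ∂(Measure.haar : Measure H))⁻¹ * u h, by fun_prop, hus.mul_left,
    fun h => mul_nonneg (inv_nonneg.2 hpos.le) (hu0 h), ?_⟩
  rw [integral_const_mul, inv_mul_cancel₀ hpos.ne']

/-- The bound is uniform in `h` because right translation by `h` neither changes the value of the
mean nor raises the multiplier norm above `‖φ‖`. -/
theorem norm_sub_integral_le {m : M0A G →ₗ[ℂ] ℂ} (hm : IsLeftInvariantMean m)
    (huniq : ∀ m', IsLeftInvariantMean m' → m' = m) (π : G →* H) (hπ : Continuous π)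
    (hsurj : Function.Surjective π) {f : G → ℂ} {ε : ℝ} (hε : 0 ≤ ε)
    (hf : ∀ φ : M0A G, ‖m φ - ∫ g, f g * φ g ∂(Measure.haar : Measure G)‖ ≤ ε * ‖φ‖)
    (φ : M0A H) (h : H) :
    ‖m (M0A.pullback π hπ 1 φ) - ∫ g, f g * φ (π g * h) ∂(Measure.haar : Measure G)‖ ≤
      ε * ‖φ‖ := by
  rw [← apply_pullback_eq hm huniq π hπ hsurj h]
  exact (hf _).trans (mul_le_mul_of_nonneg_left (M0A.norm_pullback_le π hπ h φ) hε)

/-- Averaging `norm_sub_integral_le` over `h` against `u` keeps the error `ε ‖φ‖`, and the averaged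
functional is integration against a function in `C_c(H)`. -/
theorem isWeakStarContinuous_pullback {m : M0A G →ₗ[ℂ] ℂ} (hm : IsLeftInvariantMean m)
    (huniq : ∀ m', IsLeftInvariantMean m' → m' = m) (hcont : IsWeakStarContinuous m)
    (π : G →* H) (hπ : Continuous π) (hsurj : Function.Surjective π) :
    IsWeakStarContinuous (m ∘ₗ M0A.pullback π hπ 1) := by
  obtain ⟨x, hx, hmx⟩ := hcont.exists_mem_predual
  let R : M0A H →L[ℂ] M0A G := (M0A.pullback π hπ 1).mkContinuous 1 fun φ => by
    rw [one_mul]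
    exact M0A.norm_pullback_le π hπ 1 φ
  refine isWeakStarContinuous_of_mem_predual (x := x ∘L R) ?_ fun φ => hmx _
  refine mem_predual_of_forall_approx fun ε hε => ?_
  obtain ⟨f, hfc, hfs, hf⟩ := exists_hasCompactSupport_of_mem_predual hx hε
  simp only [← hmx] at hf
  obtain ⟨u₀, hu₀c, hu₀s, hu₀0, hu₀1⟩ := exists_integral_eq_one H
  let u : H → ℂ := fun h => u₀ h
  have huc : Continuous u := by fun_prop
  have hus : HasCompactSupport u := hu₀s.comp_left (g := fun r : ℝ => (r : ℂ)) Complex.ofReal_zero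
  have hu1 : ∫ h, u h ∂(Measure.haar : Measure H) = 1 := by
    rw [← Complex.ofReal_one, ← hu₀1]
    exact integral_ofReal
  refine ⟨fun y => ∫ g, f g * u ((π g)⁻¹ * y) ∂(Measure.haar : Measure G),
    (continuous_integral_mul_apply hfc hfs π hπ huc (fun a b => a⁻¹ * b)
      (by fun_prop)).integrable_of_hasCompactSupport (hasCompactSupport_smear hfs π hπ hus),
    fun φ => ?_⟩
  rw [integral_smear_mul hfc hfs π hπ huc hus]
  have hx' : (x ∘L R) φ = m (M0A.pullback π hπ 1 φ) := (hmx _).symm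
  have h1 : Integrable (fun h => u h * m (M0A.pullback π hπ 1 φ)) (Measure.haar : Measure H) :=
    (huc.integrable_of_hasCompactSupport hus).mul_const _
  have h2 : Integrable (fun h => u h * ∫ g, f g * φ (π g * h) ∂(Measure.haar : Measure G))
      (Measure.haar : Measure H) :=
    (huc.mul (continuous_integral_mul_apply hfc hfs π hπ (M0A.continuous_coe φ) (fun a b => a * b)
      (by fun_prop))).integrable_of_hasCompactSupport hus.mul_right
  rw [hx', ← one_mul (m _), ← hu1, ← integral_mul_const, ← integral_sub h1 h2]
  refine (norm_integral_le_of_norm_le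
    ((hu₀c.integrable_of_hasCompactSupport hu₀s).mul_const (ε * ‖φ‖))
    (.of_forall fun h => ?_)).trans_eq ?_
  · rw [← mul_sub, norm_mul, Complex.norm_real, Real.norm_of_nonneg (hu₀0 h)]
    exact mul_le_mul_of_nonneg_left
      (norm_sub_integral_le hm huniq π hπ hsurj hε.le hf φ h) (hu₀0 h)
  · rw [integral_mul_const, hu₀1, one_mul]

/-- An average `∫ f(g) φ(π(g) ·) dg` is a uniform limit of linear combinations of translates of
`φ`, with coefficients summing up to almost `∫ f`. -/
theorem exists_translate_combination {f : G → ℂ} (hfc : Continuous f) (hfs : HasCompactSupport f)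
    (π : G →* H) (hπ : Continuous π) (φ : M0A H) {m : M0A H →ₗ[ℂ] ℂ} (hm : IsLeftInvariantMean m)
    {δ : ℝ} (hδ : 0 < δ) : ∃ (ψ : M0A H) (a : ℂ), m ψ = a * m φ ∧
      ‖a - ∫ g, f g ∂(Measure.haar : Measure G)‖ ≤ δ ∧
      ∀ h, ‖ψ h - ∫ g, f g * φ (π g * h) ∂(Measure.haar : Measure G)‖ ≤ δ := by
  obtain ⟨M, hM, C, hC⟩ := φ.2
  obtain ⟨K, _, _, _, P, Q, hPQ, hP, hQ, -, hQc⟩ := exists_continuous_factorization hM hC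
  -- Pairing with `p h` evaluates the translate `φ (k ·)` at `h`. The extra coordinate `1`, read off
  -- by `e`, records the sum of the coefficients, so one approximation controls both.
  let q : H → WithLp 2 (K × ℂ) := fun k => WithLp.toLp 2 (Q k⁻¹, 1)
  let e : WithLp 2 (K × ℂ) := WithLp.toLp 2 (0, 1)
  let p : H → WithLp 2 (K × ℂ) := fun h => WithLp.toLp 2 (P h, 0)
  have hqe : ∀ k, inner ℂ (q k) e = 1 := fun k => by simp [q, e, WithLp.prod_inner_apply]
  have hqp : ∀ k h, inner ℂ (q k) (p h) = φ (k * h) := fun k h => by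
    simp only [q, p, WithLp.prod_inner_apply, inner_zero_right, add_zero, hPQ, inv_inv]
  have hqc : ∀ x, Continuous fun k => inner ℂ (q k) x := fun x => by
    have h1 : Continuous fun k => inner ℂ (Q k⁻¹) (WithLp.fst x) := by
      have := Complex.continuous_conj.comp ((hQc (WithLp.fst x)).comp continuous_inv)
      exact this.congr fun k => inner_conj_symm _ _
    exact h1.add (continuous_const (y := inner ℂ (1 : ℂ) (WithLp.snd x)))
  have hfi : Integrable f (Measure.haar : Measure G) := hfc.integrable_of_hasCompactSupport hfs
  have hC0 : 0 ≤ C := (sq_nonneg _).trans (hP 1)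
  have hqn : ∀ k, ‖q k‖ ≤ √(C + 1) := fun k => by
    refine Real.le_sqrt_of_sq_le ?_
    rw [WithLp.prod_norm_sq_eq_of_L2]
    simpa [q] using hQ k⁻¹
  have hint : ∀ x, Integrable (fun g => f g * inner ℂ (q (π g)) x) (Measure.haar : Measure G) :=
    fun x => (hfc.mul ((hqc x).comp hπ)).integrable_of_hasCompactSupport hfs.mul_right
  let ℓ : StrongDual ℂ (WithLp 2 (K × ℂ)) := LinearMap.mkContinuous
    { toFun := fun x => ∫ g, f g * inner ℂ (q (π g)) x ∂(Measure.haar : Measure G)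
      map_add' := fun x y => by
        simp only [inner_add_right, mul_add]
        exact integral_add (hint x) (hint y)
      map_smul' := fun c x => by
        simp only [inner_smul_right, RingHom.id_apply, smul_eq_mul, mul_left_comm _ c]
        exact integral_const_mul _ _ }
    ((∫ g, ‖f g‖ ∂(Measure.haar : Measure G)) * √(C + 1)) fun x => by
      rw [mul_assoc, ← integral_mul_const]
      refine norm_integral_le_of_norm_le (hfi.norm.mul_const _) (.of_forall fun g => ?_)
      rw [norm_mul]
      gcongr
      exact (norm_inner_le_norm _ _).trans (by gcongr; exact hqn _)
  -- The weak integral of `q ∘ π` against `f`, up to conjugation of the coefficients. Norm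
  -- approximation of `z` from the span of `q` is uniform in `h` since `p` is bounded.
  let z := (InnerProductSpace.toDual ℂ (WithLp 2 (K × ℂ))).symm ℓ
  have hz : ∀ x, inner ℂ z x = ∫ g, f g * inner ℂ (q (π g)) x ∂(Measure.haar : Measure G) :=
    fun x => InnerProductSpace.toDual_symm_apply
  -- A vector orthogonal to every `q k` is orthogonal to `z`, so `z` lies in the double orthogonal
  -- complement.
  have hzmem : z ∈ closure (Submodule.span ℂ (Set.range q) : Set (WithLp 2 (K × ℂ))) := by
    rw [← Submodule.topologicalClosure_coe, SetLike.mem_coe,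
      ← Submodule.orthogonal_orthogonal_eq_closure, Submodule.mem_orthogonal']
    intro x hx
    rw [hz]
    refine integral_eq_zero_of_ae (.of_forall fun g => ?_)
    simp only []
    rw [Submodule.inner_right_of_mem_orthogonal
      (Submodule.subset_span (Set.mem_range_self (π g))) hx, mul_zero]
    rfl
  have hspan : ∀ y ∈ Submodule.span ℂ (Set.range q), ∃ ψ : M0A H,
      (∀ h, ψ h = inner ℂ y (p h)) ∧ m ψ = inner ℂ y e * m φ := by
    intro y hy
    induction hy using Submodule.span_induction with
    | mem y hy =>
      obtain ⟨k, rfl⟩ := hy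
      refine ⟨M0A.translate k⁻¹ φ, fun h => ?_, ?_⟩
      · rw [M0A.translate_apply, inv_inv, hqp]
      · rw [hm.map_translate, hqe, one_mul]
    | zero => exact ⟨0, fun h => (inner_zero_left _).symm, by simp⟩
    | add y y' _ _ hy hy' =>
      obtain ⟨ψ, h1, h2⟩ := hy
      obtain ⟨ψ', h1', h2'⟩ := hy'
      refine ⟨ψ + ψ', fun h => ?_, ?_⟩
      · rw [M0A.add_apply, h1, h1', inner_add_left]
      · rw [map_add, h2, h2', inner_add_left, add_mul]
    | smul c y _ hy =>
      obtain ⟨ψ, h1, h2⟩ := hy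
      refine ⟨conj c • ψ, fun h => ?_, ?_⟩
      · rw [M0A.smul_apply, h1, inner_smul_left]
      · rw [map_smul, h2, inner_smul_left, smul_eq_mul, mul_assoc]
  have hd : 0 < √C + 1 := by positivity
  obtain ⟨y, hy, hyz⟩ := Metric.mem_closure_iff.1 hzmem (δ / (√C + 1)) (by positivity)
  rw [dist_eq_norm, norm_sub_rev] at hyz
  obtain ⟨ψ, h1, h2⟩ := hspan y hy
  have hbound : ∀ x : WithLp 2 (K × ℂ), ‖x‖ ≤ √C + 1 → ‖inner ℂ y x - inner ℂ z x‖ ≤ δ :=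
    fun x hx => by
    rw [← inner_sub_left]
    calc ‖inner ℂ (y - z) x‖ ≤ ‖y - z‖ * ‖x‖ := norm_inner_le_norm _ _
      _ ≤ δ / (√C + 1) * (√C + 1) := by gcongr
      _ = δ := div_mul_cancel₀ _ hd.ne'
  refine ⟨ψ, inner ℂ y e, h2, ?_, fun h => ?_⟩
  · have := hbound e (by simp [e])
    simpa only [hz, hqe, mul_one] using this
  · have := hbound (p h) (by
      have : ‖P h‖ ≤ √C := Real.le_sqrt_of_sq_le (hP h)
      simp only [p, WithLp.norm_toLp_fst]
      linarith)
    simpa only [hz, hqp, ← h1] using this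

/-- The average of `φ` is never fed to `m'`, so it need not be a multiplier; only the combinations
`ψ` of translates are. They are uniformly close to the constant `t`, while `m' ψ = a * m' φ` with
`a` close to `1`. -/
theorem IsLeftInvariantMean.eq_pullback {m : M0A G →ₗ[ℂ] ℂ} (hm : IsLeftInvariantMean m)
    (huniq : ∀ m', IsLeftInvariantMean m' → m' = m) (hcont : IsWeakStarContinuous m)
    (π : G →* H) (hπ : Continuous π) (hsurj : Function.Surjective π) {m' : M0A H →ₗ[ℂ] ℂ}
    (hm' : IsLeftInvariantMean m') : m' = m ∘ₗ M0A.pullback π hπ 1 := by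
  obtain ⟨x, hx, hmx⟩ := hcont.exists_mem_predual
  ext φ
  rw [LinearMap.comp_apply]
  set t := m (M0A.pullback π hπ 1 φ) with ht
  -- The first term comes from the error `1 - a`, the second from the distance of `ψ` to the
  -- constant `t`.
  set D : ℝ := (1 + ‖(1 : M0A G)‖) * ‖m' φ‖ + (1 + ‖φ‖) with hD
  have hDpos : 0 < D := by positivity
  have key : ∀ ε > 0, ‖m' φ - t‖ ≤ ε * D := by
    intro ε hε
    obtain ⟨f, hfc, hfs, hf⟩ := exists_hasCompactSupport_of_mem_predual hx hε
    simp only [← hmx] at hf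
    obtain ⟨ψ, a, hψ, ha, hψf⟩ := exists_translate_combination hfc hfs π hπ φ hm' hε
    have h1 : ‖1 - a‖ ≤ ε * (1 + ‖(1 : M0A G)‖) := by
      have h2 := hf 1
      simp only [hm.map_one, M0A.one_apply, mul_one] at h2
      calc ‖1 - a‖ = ‖(1 - ∫ g, f g ∂(Measure.haar : Measure G)) -
              (a - ∫ g, f g ∂(Measure.haar : Measure G))‖ := by rw [sub_sub_sub_cancel_right]
        _ ≤ ε * ‖(1 : M0A G)‖ + ε := (norm_sub_le _ _).trans (add_le_add h2 ha)
        _ = _ := by ring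
    have h3 : ‖a * m' φ - t‖ ≤ ε * (1 + ‖φ‖) := by
      have h4 : m' (ψ - t • 1) = a * m' φ - t := by
        rw [map_sub, map_smul, hm'.map_one, hψ, smul_eq_mul, mul_one]
      rw [← h4]
      refine hm'.norm_le _ _ fun h => ?_
      have h5 : (ψ - t • 1 : M0A H) h = ψ h - t := by
        rw [sub_eq_add_neg, ← neg_smul, M0A.add_apply, M0A.smul_apply, M0A.one_apply, mul_one,
          sub_eq_add_neg]
      rw [h5]
      calc ‖ψ h - t‖ = ‖(ψ h - ∫ g, f g * φ (π g * h) ∂(Measure.haar : Measure G)) -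
              (t - ∫ g, f g * φ (π g * h) ∂(Measure.haar : Measure G))‖ := by
            rw [sub_sub_sub_cancel_right]
        _ ≤ ε + ε * ‖φ‖ := (norm_sub_le _ _).trans (add_le_add (hψf h)
            (norm_sub_integral_le hm huniq π hπ hsurj hε.le hf φ h))
        _ = _ := by ring
    calc ‖m' φ - t‖ = ‖(1 - a) * m' φ + (a * m' φ - t)‖ := by congr 1; ring
      _ ≤ ε * (1 + ‖(1 : M0A G)‖) * ‖m' φ‖ + ε * (1 + ‖φ‖) := by
          refine (norm_add_le _ _).trans (add_le_add ?_ h3)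
          rw [norm_mul]
          gcongr
      _ = ε * D := by rw [hD]; ring
  rw [← sub_eq_zero, ← norm_le_zero_iff]
  refine le_of_forall_pos_le_add fun ε hε => ?_
  rw [zero_add]
  simpa [hDpos.ne'] using key (ε / D) (div_pos hε hDpos)

end Means

end PropTStar

end

theorem mainTheorem11 {G : Type*} [Group G] [TopologicalSpace G] [IsTopologicalGroup G]
    [LocallyCompactSpace G] [T2Space G] (hG : PropTStar.PropertyTStar G)
    (N : Subgroup G) [N.Normal] (hN : IsClosed (N : Set G)) :
    PropTStar.PropertyTStar (G ⧸ N) := by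
  let _ : MeasurableSpace G := borel G
  have _ : BorelSpace G := ⟨rfl⟩
  let _ : MeasurableSpace (G ⧸ N) := borel (G ⧸ N)
  have _ : BorelSpace (G ⧸ N) := ⟨rfl⟩
  obtain ⟨m, ⟨hm, huniq⟩, hcont⟩ := hG
  have hπ : Continuous (QuotientGroup.mk' N) := QuotientGroup.continuous_mk
  have hsurj := QuotientGroup.mk'_surjective N
  exact ⟨m ∘ₗ PropTStar.M0A.pullback (QuotientGroup.mk' N) hπ 1,
    ⟨hm.pullback _ hπ hsurj 1, fun m' hm' => hm.eq_pullback huniq hcont _ hπ hsurj hm'⟩,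
    PropTStar.isWeakStarContinuous_pullback hm huniq hcont _ hπ hsurj⟩
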